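/- **Setting.** Let $\theta=(\theta_y,\theta_u)\in\mathbb R^{n_y}\times\mathbb R^{n_u}$ with the Euclidean norm, and let $j,e:\mathbb R^{n_y}\times\mathbb R^{n_u}\to\mathbb R$ satisfy, with constants $\rho>0$ and $L_j,L_e\ge 0$: (A1) $\underline j:=\inf_\theta j(\theta)>-\infty$, and $\theta\mapsto e(\theta)+\frac{\rho}{2}\|\theta\|^2$ is convex; (A2) $j$ and $e$ are differentiable and $\nabla j$, $\nabla e$ are Lipschitz continuous with constants $L_j$, $L_e$. For $\gamma\in(0,\frac1{2\rho})$ let $$e_\gamma(\theta)=\min_z\Big\{e(z,\theta_u)+\tfrac1{2\gamma}\|z-\theta_y\|^2\Big\},\qquad z^*_\gamma(\theta)=\arg\min_z\Big\{e(z,\theta_u)+\tfrac1{2\gamma}\|z-\theta_y\|^2\Big\},$$ and, for $c>0$, $\phi_c(\theta)=\frac1c\,(j(\theta)-\underline j)+e(\theta)-e_\gamma(\theta)$. (The minimizer exists and is unique, and $\phi_c$ is differentiable.) **Algorithm (S2-FOBA).** Let $\mathcal T_0,\mathcal T_{1/2},\mathcal T_1,\mathcal T_{3/2},\dots$ be random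 training sets, and let $\mathcal F_k=\sigma(\mathcal T_0,\mathcal T_{1/2},\dots,\mathcal T_{k-1/2})$ and $\mathcal F_{k+1/2}=\sigma(\mathcal T_0,\mathcal T_{1/2},\dots,\mathcal T_{k})$ be the $\sigma$-algebras generated by the training sets drawn before $\mathcal T_k$ and before $\mathcal T_{k+1/2}$, respectively. Let $G_j(\mathcal T,\theta)$ and $G_e(\mathcal T,\theta)$ be stochastic gradients of $j$ and $e$ at $\theta$, computed measurably from a training set $\mathcal T$ and the point $\theta$ (for example mini-batch averages of gradients of sample losses). From deterministic $\theta^0=(\theta_y^0,\theta_u^0)$ and $z^0$, iterate $$z^{k+1}=z^k-\eta_k\Big(h^k_{e_y,z}+\tfrac1\gamma(z^k-\theta^k_y)\Big),\qquad \theta_y^{k+1}=\theta_y^k-\alpha_k\Big(\tfrac1{c_k}h^k_{j_y}+h^k_{e_y}-\tfrac1\gamma(\theta_y^k-z^{k+1})\Big),$$ $$\theta_u^{k+1}=\theta_u^k-\beta_k\Big(\tfrac1{c_k}h^k_{j_u}+h^k_{e_u}-h^k_{e_u,z}\Big),$$ where $h^k_{j_y},h^k_{e_y},h^k_{e_y,z}$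 are the $\theta_y$-components of $G_j(\mathcal T_k,\theta^k)$, $G_e(\mathcal T_k,\theta^k)$, $G_e(\mathcal T_k,(z^k,\theta_u^k))$, and $h^k_{j_u},h^k_{e_u},h^k_{e_u,z}$ are the $\theta_u$-components of $G_j(\mathcal T_{k+1/2},\theta^{k+1/2})$, $G_e(\mathcal T_{k+1/2},\theta^{k+1/2})$, $G_e(\mathcal T_{k+1/2},(z^{k+1},\theta_u^k))$, with $\theta^k=(\theta_y^k,\theta_u^k)$ and $\theta^{k+1/2}=(\theta_y^{k+1},\theta_u^k)$. (A3) For every $k$, conditionally on $\mathcal F_k$, the vectors $h^k_{j_y},h^k_{e_y},h^k_{e_y,z}$ are unbiased estimators of $\nabla_{\theta_y}j(\theta^k)$, $\nabla_{\theta_y}e(\theta^k)$, $\nabla_{\theta_y}e(z^k,\theta^k_u)$ with variances at most $\sigma_j^2,\sigma_e^2,\sigma_e^2$; and, conditionally on $\mathcal F_{k+1/2}$, the vectors $h^k_{j_u},h^k_{e_u},h^k_{e_u,z}$ are unbiased estimators of $\nabla_{\theta_u}j(\theta^{k+1/2})$, $\nabla_{\theta_u}e(\theta^{k+1/2})$,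 $\nabla_{\theta_u}e(z^{k+1},\theta^k_u)$ with variances at most $\sigma_j^2,\sigma_e^2,\sigma_e^2$. **Theorem.** Assume (A1)–(A3), $\gamma\in(0,\frac1{2\rho})$, and $$\alpha_k=\alpha_0(k+1)^{-p},\quad \beta_k=\beta_0(k+1)^{-p},\quad \eta_k=\eta_0(k+1)^{-q},\qquad q\in(\tfrac12,1),\ p\in(\tfrac{q+1}2,1),$$ with $\eta_0\in\big(0,\frac{2}{L_e+2/\gamma-\rho}\big)$, $\alpha_0,\beta_0>0$, and let $(c_k)$ be nondecreasing with $c_0>0$. Put $$V_k=\phi_{c_k}(\theta^k)+C_z\|z^k-z^*_\gamma(\theta^k)\|^2,\qquad C_z=\frac{6(1+L_e^2)}{\gamma-\gamma^2\rho}.$$ There are $\delta>0$ and $C_\sigma>0$, depending only on $n_y,n_u,j,e,L_j,L_e,\rho,\gamma,\eta_0,c_0$, such that whenever $\alpha_0,\beta_0\le\delta$, all expectations below are finite and: 1. for all $k\ge0$, $$\mathbb E[V_{k+1}]+\frac{\alpha_k}{2}\mathbb E\|\nabla_{\theta_y}\phi_{c_k}(\theta^k)\|^2+\frac{\beta_k}{2}\mathbb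 E\|\nabla_{\theta_u}\phi_{c_k}(\theta^{k+1/2})\|^2\le \mathbb E[V_k]+\Big(\frac{\alpha_k^2}{\eta_k}+\frac{\beta_k^2}{\eta_k}+\eta_k^2\Big)C_\sigma(\sigma_j^2+\sigma_e^2),$$ and $\sum_k\big(\frac{\alpha_k^2}{\eta_k}+\frac{\beta_k^2}{\eta_k}+\eta_k^2\big)<\infty$; 2. there is $M_V>0$, depending only on the above data and on $\alpha_0,\beta_0,p,q,\sigma_j,\sigma_e$, such that for all $K\ge0$ $$\mathbb E[V_{K+1}]+\sum_{k=0}^K\frac{\alpha_k}2\mathbb E\|\nabla_{\theta_y}\phi_{c_k}(\theta^k)\|^2+\sum_{k=0}^K\frac{\beta_k}2\mathbb E\|\nabla_{\theta_u}\phi_{c_k}(\theta^{k+1/2})\|^2\le V_0+M_V;$$ in particular $0\le\mathbb E[V_k]\le V_0+M_V$ for all $k$, and $\sum_k\alpha_k\mathbb E\|\nabla_{\theta_y}\phi_{c_k}(\theta^k)\|^2$ and $\sum_k\beta_k\mathbb E\|\nabla_{\theta_u}\phi_{c_k}(\theta^{k+1/2})\|^2$ converge; 3. as $K\to\infty$,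 $$\min_{0\le k\le K}\mathbb E\big[\|\nabla_{\theta_y}\phi_{c_k}(\theta^k)\|+\|\nabla_{\theta_u}\phi_{c_k}(\theta^{k+1/2})\|\big]=\mathcal O\big(K^{-(1-p)/2}\big).$$ -/

import Mathlib

open MeasureTheory Set Filter
open scoped NNReal

noncomputable section

namespace S2FOBA

/-- Parameters of the lower-level variable (`θ_y` and the auxiliary variable `z`)
or of the upper-level variable (`θ_u`): the Euclidean space `ℝⁿ`. -/
abbrev Vec (n : ℕ) : Type := EuclideanSpace ℝ (Fin n)

/-- The joint parameter `θ = (θ_y, θ_u)`, with the Euclidean norm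
`‖θ‖² = ‖θ_y‖² + ‖θ_u‖²`. Its components are `θ.fst` and `θ.snd`. -/
abbrev Param (ny nu : ℕ) : Type := WithLp 2 (Vec ny × Vec nu)

/-- The pair `(y, u)` as a joint parameter. -/
def pair {ny nu : ℕ} (y : Vec ny) (u : Vec nu) : Param ny nu := WithLp.toLp 2 (y, u)

/-- `f` is `L`-smooth: its gradient exists everywhere and is `L`-Lipschitz. -/
def IsSmooth {ny nu : ℕ} (L : ℝ≥0) (f : Param ny nu → ℝ) : Prop :=
  Differentiable ℝ f ∧ LipschitzWith L (gradient f)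

/-- `f` is `ρ`-weakly convex: `f + (ρ/2)‖·‖²` is convex. -/
def IsWeaklyConvex {ny nu : ℕ} (ρ : ℝ) (f : Param ny nu → ℝ) : Prop :=
  ConvexOn ℝ univ fun θ => f θ + ρ / 2 * ‖θ‖ ^ 2

/-- Partial gradient in `θ_y`: the `θ_y`-component of the gradient. -/
def gradY {ny nu : ℕ} (f : Param ny nu → ℝ) (θ : Param ny nu) : Vec ny := (gradient f θ).fst

/-- Partial gradient in `θ_u`: the `θ_u`-component of the gradient. -/
def gradU {ny nu : ℕ} (f : Param ny nu → ℝ) (θ : Param ny nu) : Vec nu := (gradient f θ).snd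

/-! ### Moreau envelope, penalized objective, merit function -/

/-- Proximal lower-level objective `z ↦ e(z, θ_u) + ‖z - θ_y‖² / (2γ)`. -/
def proxObj {ny nu : ℕ} (e : Param ny nu → ℝ) (γ : ℝ) (θ : Param ny nu) (z : Vec ny) : ℝ :=
  e (pair z θ.snd) + 1 / (2 * γ) * ‖z - θ.fst‖ ^ 2

/-- Moreau envelope `e_γ(θ)`, the minimum of the proximal objective. -/
def moreau {ny nu : ℕ} (e : Param ny nu → ℝ) (γ : ℝ) (θ : Param ny nu) : ℝ :=
  ⨅ z, proxObj e γ θ z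

/-- Proximal point `z*_γ(θ)`: the minimizer of the proximal objective. (It exists and is unique
under the hypotheses of the theorem; this is part of the conclusion there.) -/
def prox {ny nu : ℕ} (e : Param ny nu → ℝ) (γ : ℝ) (θ : Param ny nu) : Vec ny :=
  Classical.epsilon fun z => IsMinOn (proxObj e γ θ) univ z

/-- `φ_c(θ) = (j(θ) - inf j) / c + (e(θ) - e_γ(θ))`. -/
def phi {ny nu : ℕ} (j e : Param ny nu → ℝ) (γ c : ℝ) (θ : Param ny nu) : ℝ :=
  1 / c * (j θ - ⨅ θ', j θ') + (e θ - moreau e γ θ)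

/-- `C_z = 6 (1 + L_e²) / (γ - γ² ρ)`. -/
def Cz (Le : ℝ≥0) (ρ γ : ℝ) : ℝ := 6 * (1 + (Le : ℝ) ^ 2) / (γ - γ ^ 2 * ρ)

/-- The merit function `φ_c(θ) + C_z ‖z - z*_γ(θ)‖²`. -/
def merit {ny nu : ℕ} (j e : Param ny nu → ℝ) (Le : ℝ≥0) (ρ γ c : ℝ)
    (θ : Param ny nu) (z : Vec ny) : ℝ :=
  phi j e γ c θ + Cz Le ρ γ * ‖z - prox e γ θ‖ ^ 2

/-! ### The algorithm -/

/-- Polynomially decaying step size `a (k+1)^{-r}`. -/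
def stepSize (a r : ℝ) (k : ℕ) : ℝ := a * ((k : ℝ) + 1) ^ (-r)

/-- The data of the algorithm. A training set is a point of `S` (for mini-batches of size `m` from
a domain `X` one has `S = (Fin m → X)`). `Gj s θ` and `Ge s θ` are the stochastic gradients of `j`
and `e` at the point `θ` computed from the training set `s` (for mini-batches these are the averages
over the batch of the gradients at `θ` of the sample losses). -/
structure Config (S : Type*) (ny nu : ℕ) where
  /-- proximal parameter -/
  γ : ℝ
  /-- step sizes for `θ_y` -/
  α : ℕ → ℝ
  /-- step sizes for `θ_u` -/
  β : ℕ → ℝ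
  /-- step sizes for `z` -/
  η : ℕ → ℝ
  /-- penalty parameters -/
  c : ℕ → ℝ
  /-- stochastic gradient of `j` -/
  Gj : S → Param ny nu → Param ny nu
  /-- stochastic gradient of `e` -/
  Ge : S → Param ny nu → Param ny nu
  /-- initial auxiliary variable -/
  z₀ : Vec ny
  /-- initial parameters -/
  θ₀ : Param ny nu

/-- The current values of `(z, θ_y, θ_u)`. -/
structure State (ny nu : ℕ) where
  /-- auxiliary variable -/
  z : Vec ny
  /-- lower-level parameter -/
  y : Vec ny
  /-- upper-level parameter -/
  u : Vec nu

namespace Config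

/-- `z^{k+1} = z^k - η_k (h_{e_y,z}^k + (z^k - θ_y^k)/γ)`, with training set `s = 𝒯_k`. -/
def zNext {S : Type*} {ny nu : ℕ} (A : Config S ny nu) (k : ℕ) (s : S) (x : State ny nu) :
    Vec ny :=
  x.z - A.η k • ((A.Ge s (pair x.z x.u)).fst + (1 / A.γ) • (x.z - x.y))

/-- `θ_y^{k+1} = θ_y^k - α_k (h_{j_y}^k / c_k + h_{e_y}^k - (θ_y^k - z^{k+1})/γ)`,
with training set `s = 𝒯_k`. -/
def yNext {S : Type*} {ny nu : ℕ} (A : Config S ny nu) (k : ℕ) (s : S) (x : State ny nu) :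
    Vec ny :=
  x.y - A.α k • ((1 / A.c k) • (A.Gj s (pair x.y x.u)).fst + (A.Ge s (pair x.y x.u)).fst
    - (1 / A.γ) • (x.y - A.zNext k s x))

/-- `θ_u^{k+1} = θ_u^k - β_k (h_{j_u}^k / c_k + h_{e_u}^k - h_{e_u,z}^k)`,
with training sets `s = 𝒯_k` and `s' = 𝒯_{k+1/2}`. -/
def uNext {S : Type*} {ny nu : ℕ} (A : Config S ny nu) (k : ℕ) (s s' : S) (x : State ny nu) :
    Vec nu :=
  x.u - A.β k • ((1 / A.c k) • (A.Gj s' (pair (A.yNext k s x) x.u)).snd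
    + (A.Ge s' (pair (A.yNext k s x) x.u)).snd - (A.Ge s' (pair (A.zNext k s x) x.u)).snd)

/-- The iterates for a given sequence of training sets, numbered by half steps:
`t (2k) = 𝒯_k` and `t (2k+1) = 𝒯_{k+1/2}`. -/
def iter {S : Type*} {ny nu : ℕ} (A : Config S ny nu) (t : ℕ → S) : ℕ → State ny nu
  | 0 => ⟨A.z₀, A.θ₀.fst, A.θ₀.snd⟩
  | k + 1 =>
    let x := A.iter t k
    ⟨A.zNext k (t (2 * k)) x, A.yNext k (t (2 * k)) x, A.uNext k (t (2 * k)) (t (2 * k + 1)) x⟩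

/-- `θ^k = (θ_y^k, θ_u^k)`. -/
def θ {S : Type*} {ny nu : ℕ} (A : Config S ny nu) (t : ℕ → S) (k : ℕ) : Param ny nu :=
  pair (A.iter t k).y (A.iter t k).u

/-- `θ^{k+1/2} = (θ_y^{k+1}, θ_u^k)`. -/
def θhalf {S : Type*} {ny nu : ℕ} (A : Config S ny nu) (t : ℕ → S) (k : ℕ) : Param ny nu :=
  pair (A.iter t (k + 1)).y (A.iter t k).u

/-- `(z^k, θ_u^k)`, the point at which `h_{e_y,z}^k` is computed. -/
def ζ {S : Type*} {ny nu : ℕ} (A : Config S ny nu) (t : ℕ → S) (k : ℕ) : Param ny nu :=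
  pair (A.iter t k).z (A.iter t k).u

/-- `(z^{k+1}, θ_u^k)`, the point at which `h_{e_u,z}^k` is computed. -/
def ζhalf {S : Type*} {ny nu : ℕ} (A : Config S ny nu) (t : ℕ → S) (k : ℕ) : Param ny nu :=
  pair (A.iter t (k + 1)).z (A.iter t k).u

end Config

/-! ### Stochastic oracles -/

/-- The σ-algebra generated by the training sets with half-step number less than `n`. So
`past T (2k)` is `ℱ_k`, generated by everything drawn before `𝒯_k`, and `past T (2k+1)` is
`ℱ_{k+1/2}`, generated by everything drawn before `𝒯_{k+1/2}` (that is, up to `𝒯_k`). -/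
abbrev past {Ω S : Type*} [MeasurableSpace S] (T : ℕ → Ω → S) (n : ℕ) : MeasurableSpace Ω :=
  ⨆ i : Fin n, MeasurableSpace.comap (T i) inferInstance

/-- The random vector `h` is, conditionally on `𝒢`, an unbiased estimator of `g` with variance at
most `σ²`. The integrability clauses say that the two conditional expectations are meaningful. -/
structure IsUnbiasedOracle {Ω : Type*} {mΩ : MeasurableSpace Ω} {n : ℕ} (μ : Measure Ω)
    (𝒢 : MeasurableSpace Ω) (h g : Ω → Vec n) (σ : ℝ) : Prop where
  integrable : Integrable h μ
  unbiased : μ[h | 𝒢] =ᵐ[μ] g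
  integrable_sq : Integrable (fun ω => ‖h ω - g ω‖ ^ 2) μ
  variance_le : ∀ᵐ ω ∂μ, (μ[fun ω => ‖h ω - g ω‖ ^ 2 | 𝒢]) ω ≤ σ ^ 2

/-- The assumption on the oracles: for every `k`, the stochastic gradients
`h_{j_y}^k, h_{e_y}^k, h_{e_y,z}^k` (computed from `𝒯_k`) are unbiased with bounded variance
conditionally on `ℱ_k`, and `h_{j_u}^k, h_{e_u}^k, h_{e_u,z}^k` (computed from `𝒯_{k+1/2}`)
are so conditionally on `ℱ_{k+1/2}`. -/
structure OracleAssumption {Ω S : Type*} {mΩ : MeasurableSpace Ω} [MeasurableSpace S]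
    {ny nu : ℕ} (μ : Measure Ω) (j e : Param ny nu → ℝ) (σj σe : ℝ)
    (A : Config S ny nu) (T : ℕ → Ω → S) : Prop where
  jy : ∀ k, IsUnbiasedOracle μ (past T (2 * k))
    (fun ω => (A.Gj (T (2 * k) ω) (A.θ (T · ω) k)).fst)
    (fun ω => gradY j (A.θ (T · ω) k)) σj
  ey : ∀ k, IsUnbiasedOracle μ (past T (2 * k))
    (fun ω => (A.Ge (T (2 * k) ω) (A.θ (T · ω) k)).fst)
    (fun ω => gradY e (A.θ (T · ω) k)) σe
  eyz : ∀ k, IsUnbiasedOracle μ (past T (2 * k))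
    (fun ω => (A.Ge (T (2 * k) ω) (A.ζ (T · ω) k)).fst)
    (fun ω => gradY e (A.ζ (T · ω) k)) σe
  ju : ∀ k, IsUnbiasedOracle μ (past T (2 * k + 1))
    (fun ω => (A.Gj (T (2 * k + 1) ω) (A.θhalf (T · ω) k)).snd)
    (fun ω => gradU j (A.θhalf (T · ω) k)) σj
  eu : ∀ k, IsUnbiasedOracle μ (past T (2 * k + 1))
    (fun ω => (A.Ge (T (2 * k + 1) ω) (A.θhalf (T · ω) k)).snd)
    (fun ω => gradU e (A.θhalf (T · ω) k)) σe
  euz : ∀ k, IsUnbiasedOracle μ (past T (2 * k + 1))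
    (fun ω => (A.Ge (T (2 * k + 1) ω) (A.ζhalf (T · ω) k)).snd)
    (fun ω => gradU e (A.ζhalf (T · ω) k)) σe

/-- `V_k`, as a function of the sequence of training sets. -/
def V {S : Type*} {ny nu : ℕ} (j e : Param ny nu → ℝ) (Le : ℝ≥0) (ρ : ℝ)
    (A : Config S ny nu) (t : ℕ → S) (k : ℕ) : ℝ :=
  merit j e Le ρ A.γ (A.c k) (A.θ t k) (A.iter t k).z

/-- `‖∇_{θ_y} φ_{c_k}(θ^k)‖`. -/
def normGradY {S : Type*} {ny nu : ℕ} (j e : Param ny nu → ℝ)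
    (A : Config S ny nu) (t : ℕ → S) (k : ℕ) : ℝ :=
  ‖gradY (phi j e A.γ (A.c k)) (A.θ t k)‖

/-- `‖∇_{θ_u} φ_{c_k}(θ^{k+1/2})‖`. -/
def normGradU {S : Type*} {ny nu : ℕ} (j e : Param ny nu → ℝ)
    (A : Config S ny nu) (t : ℕ → S) (k : ℕ) : ℝ :=
  ‖gradU (phi j e A.γ (A.c k)) (A.θhalf t k)‖

end S2FOBA

end

/-! The method is block gradient descent on `φ_c` in which the proximal point is replaced by the
auxiliary variable `z`, itself driven by a stochastic gradient step on the proximal objective. The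
proof balances the descent of `φ_c` against the tracking error `‖z - z*_γ(θ)‖²`.

Deterministic facts. With `m = 1/γ - ρ > 0` the proximal objective is `m`-strongly convex and
smooth, so the proximal point is Lipschitz in `θ`. Hence the Moreau envelope has a Lipschitz
gradient (`LowerLevel.moreau_hasGradientAt`), and the descent lemma holds for `φ_c` uniformly in `c
≥ c₀`. A noise-free `z`-step contracts the squared tracking error by `1 - η m`
(`LowerLevel.norm_proxGrad_step_sub_prox_sq_le`).

Stochastic facts. Each update direction of `θ` is the partial gradient of `φ_c`, plus a bias
controlled by the tracking error, plus noise centred conditionally on the past. Conditional centring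
removes the cross terms (`IsNoise.expected_descent`).

Balance. A move of `θ` by a vector `v` displaces the proximal point by at most a constant times
`‖v‖`. Young's inequality with parameter `η m / 2` gives up half of the contraction and charges
order `‖v‖²/η` for the displacement, where `‖v‖²` is of order `α² + β²`; this produces the noise
terms `α²/η` and `β²/η`, while the noise of the `z`-step gives `η²`. The other half of the
contraction pays for the biases. Everything left over is absorbed because `α/η` and `β/η` are at
most `δ/η₀` with `δ` small (`merit_descent_arith`); of `C_z` only positivity matters. The noise
terms are summable since `2q > 1` and `2p - q > 1`, so the one-step inequality telescopes, and the
rate follows by comparing the minimum with the weighted sum. -/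

noncomputable section

namespace S2FOBA

/-! ### Quadratic models of smooth and weakly convex functions -/

section Smooth

variable {H : Type*} [NormedAddCommGroup H] [InnerProductSpace ℝ H]

/-- The quadratic upper model of `f` with slope field `f'` and curvature `M`. -/
def QuadUpper (f : H → ℝ) (f' : H → H) (M : ℝ) : Prop :=
  ∀ x y, f y ≤ f x + inner ℝ (f' x) (y - x) + M / 2 * ‖y - x‖ ^ 2

/-- The quadratic lower model of `f` with slope field `f'` and curvature `m`. -/
def QuadLower (f : H → ℝ) (f' : H → H) (m : ℝ) : Prop :=
  ∀ x y, f x + inner ℝ (f' x) (y - x) + m / 2 * ‖y - x‖ ^ 2 ≤ f y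

lemma half_sq_norm_expand (x y : H) :
    1 / 2 * ‖y‖ ^ 2 = 1 / 2 * ‖x‖ ^ 2 + inner ℝ x (y - x) + 1 / 2 * ‖y - x‖ ^ 2 := by
  have h : ‖y‖ ^ 2 = ‖x + (y - x)‖ ^ 2 := by congr 2; abel
  rw [h, norm_add_sq_real]; ring

/-- Used with `r = 1/γ` to build the proximal objective, and with `r = -m` to strip a strongly
convex function of its convexity modulus. -/
lemma QuadUpper.add_sq {f : H → ℝ} {f' : H → H} {M : ℝ} (h : QuadUpper f f' M) (r : ℝ) (a : H) :
    QuadUpper (fun x => f x + r / 2 * ‖x - a‖ ^ 2) (fun x => f' x + r • (x - a)) (M + r) := by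
  intro x y
  have h1 := h x y
  have h2 := half_sq_norm_expand (x - a) (y - a)
  rw [sub_sub_sub_cancel_right] at h2
  simp only [inner_add_left, real_inner_smul_left]
  linear_combination h1 + r * h2

lemma QuadLower.add_sq {f : H → ℝ} {f' : H → H} {m : ℝ} (h : QuadLower f f' m) (r : ℝ) (a : H) :
    QuadLower (fun x => f x + r / 2 * ‖x - a‖ ^ 2) (fun x => f' x + r • (x - a)) (m + r) := by
  intro x y
  have h1 := h x y
  have h2 := half_sq_norm_expand (x - a) (y - a)
  rw [sub_sub_sub_cancel_right] at h2
  simp only [inner_add_left, real_inner_smul_left]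
  linear_combination h1 - r * h2

lemma QuadLower.strong_monotone {f : H → ℝ} {f' : H → H} {m : ℝ} (h : QuadLower f f' m) (x y : H) :
    m * ‖x - y‖ ^ 2 ≤ inner ℝ (f' x - f' y) (x - y) := by
  have h1 := h x y
  have h2 := h y x
  rw [← neg_sub x y, inner_neg_right, norm_neg] at h1
  rw [inner_sub_left]
  linarith

/-- The improved first-order lower bound for a convex function with an upper quadratic model. -/
lemma QuadLower.improved {f : H → ℝ} {f' : H → H} {M : ℝ} (hM : 0 < M)
    (hl : QuadLower f f' 0) (hu : QuadUpper f f' M) (x y : H) :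
    f x + inner ℝ (f' x) (y - x) + 1 / (2 * M) * ‖f' y - f' x‖ ^ 2 ≤ f y := by
  set g := f' y - f' x with hg
  -- The test point is the minimizer of the upper model at `y` of `f - ⟨f' x, ·⟩`; the lower model
  -- at `x` and the upper model at `y` are compared there.
  have h1 := hl x (y - (1 / M) • g)
  have h2 := hu y (y - (1 / M) • g)
  have e1 : y - (1 / M) • g - x = (y - x) - (1 / M) • g := by abel
  have e2 : y - (1 / M) • g - y = -((1 / M) • g) := by abel
  rw [e1, inner_sub_right, real_inner_smul_right] at h1
  rw [e2, inner_neg_right, real_inner_smul_right, norm_neg, norm_smul, mul_pow] at h2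
  have h3 : inner ℝ (f' y) g = inner ℝ (f' x) g + ‖g‖ ^ 2 := by
    rw [← real_inner_self_eq_norm_sq, ← inner_add_left]; congr 1; rw [hg]; abel
  rw [h3] at h2
  have h4 : ‖1 / M‖ ^ 2 = 1 / M ^ 2 := by simp
  rw [h4] at h2
  have h5 : M / 2 * (1 / M ^ 2 * ‖g‖ ^ 2) = 1 / (2 * M) * ‖g‖ ^ 2 := by field_simp
  have h6 : 1 / M * ‖g‖ ^ 2 = 2 * (1 / (2 * M) * ‖g‖ ^ 2) := by field_simp
  rw [h5] at h2
  simp only [zero_div, zero_mul, add_zero, mul_add] at h1 h2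
  linarith

/-- Cocoercivity (Baillon-Haddad). -/
lemma QuadLower.cocoercive {f : H → ℝ} {f' : H → H} {M : ℝ} (hM : 0 < M)
    (hl : QuadLower f f' 0) (hu : QuadUpper f f' M) (x y : H) :
    ‖f' x - f' y‖ ^ 2 ≤ M * inner ℝ (f' x - f' y) (x - y) := by
  have h1 := hl.improved hM hu x y
  have h2 := hl.improved hM hu y x
  rw [← neg_sub x y, inner_neg_right, ← neg_sub (f' x) (f' y), norm_neg] at h1
  rw [inner_sub_left]
  have h6 : 1 / (2 * M) * ‖f' x - f' y‖ ^ 2 + 1 / (2 * M) * ‖f' x - f' y‖ ^ 2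
    = ‖f' x - f' y‖ ^ 2 / M := by field_simp; ring
  have : ‖f' x - f' y‖ ^ 2 / M ≤ inner ℝ (f' x) (x - y) - inner ℝ (f' y) (x - y) := by linarith
  rwa [div_le_iff₀' hM] at this

/-- A gradient step on a strongly convex smooth function is a contraction. -/
lemma gradient_step_contraction {f : H → ℝ} {f' : H → H} {m M η : ℝ} (hm : 0 ≤ m) (hmM : m < M)
    (hl : QuadLower f f' m) (hu : QuadUpper f f' M) (hη : 0 ≤ η) (hη' : η * (M + m) ≤ 2)
    (x y : H) :
    ‖(x - η • f' x) - (y - η • f' y)‖ ^ 2 ≤ (1 - η * m) * ‖x - y‖ ^ 2 := by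
  -- Subtracting `m/2 ‖·‖²` leaves a convex function of curvature `M - m`, whose slope difference
  -- `p` is cocoercive. After expansion the coefficient of `⟨p, x - y⟩` is at most `-η (2 - η (M +
  -- m)) ≤ 0`, and `(1 - η m)² ≤ 1 - η m` because `0 ≤ η m ≤ 1`.
  have hl' := hl.add_sq (-m) 0
  have hu' := hu.add_sq (-m) 0
  rw [add_neg_cancel] at hl'
  have hc := hl'.cocoercive (by linarith) hu' x y
  set p := (f' x + -m • (x - 0)) - (f' y + -m • (y - 0)) with hp
  have e : (x - η • f' x) - (y - η • f' y) = (1 - η * m) • (x - y) - η • p := by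
    rw [hp]; module
  rw [e, norm_sub_sq_real, real_inner_smul_left, real_inner_smul_right, norm_smul, norm_smul,
    mul_pow, mul_pow, Real.norm_eq_abs, Real.norm_eq_abs, sq_abs, sq_abs, real_inner_comm]
  have hip : 0 ≤ inner ℝ p (x - y) := by
    by_contra hneg
    have := mul_neg_of_pos_of_neg (show 0 < M + -m by linarith) (not_le.mp hneg)
    nlinarith [sq_nonneg ‖p‖]
  have h1 : η ^ 2 * ‖p‖ ^ 2 ≤ η ^ 2 * ((M + -m) * inner ℝ p (x - y)) :=
    mul_le_mul_of_nonneg_left hc (sq_nonneg _)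
  have h2 : 0 ≤ η * (2 - η * (M + m)) * inner ℝ p (x - y) :=
    mul_nonneg (mul_nonneg hη (by linarith)) hip
  have h3 : 0 ≤ η * m * (1 - η * m) * ‖x - y‖ ^ 2 := by
    refine mul_nonneg (mul_nonneg (mul_nonneg hη hm) ?_) (sq_nonneg _)
    nlinarith [mul_nonneg hη (show 0 ≤ M - m by linarith)]
  nlinarith

lemma continuous_of_differentiable {f : H → ℝ} (hf : Differentiable ℝ f) : Continuous f :=
  hf.continuous

variable [CompleteSpace H]

lemma hasDerivAt_comp_line {f : H → ℝ} (hf : Differentiable ℝ f) (x v : H) (t : ℝ) :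
    HasDerivAt (fun t : ℝ => f (x + t • v)) (inner ℝ (gradient f (x + t • v)) v) t := by
  have h1 : HasDerivAt (fun t : ℝ => x + t • v) v t := by
    simpa using ((hasDerivAt_id t).smul_const v).const_add x
  have h2 := (hf (x + t • v)).hasGradientAt.hasFDerivAt.comp_hasDerivAt t h1
  exact h2.congr_deriv (by simp)

/-- The descent lemma. -/
lemma quadUpper_of_lipschitz {f : H → ℝ} (hf : Differentiable ℝ f) {L : ℝ}
    (hL : ∀ x y, ‖gradient f x - gradient f y‖ ≤ L * ‖x - y‖) : QuadUpper f (gradient f) L := by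
  intro x y
  set v := y - x with hv
  -- `ψ` is the gap between `f` and its model along the segment, up to a constant; the Lipschitz
  -- bound makes it decrease on `[0, 1]`.
  set ψ : ℝ → ℝ := fun t => f (x + t • v) - t * inner ℝ (gradient f x) v - L / 2 * ‖v‖ ^ 2 * t ^ 2
  have hd : ∀ t, HasDerivAt ψ (inner ℝ (gradient f (x + t • v)) v - inner ℝ (gradient f x) v
      - L / 2 * ‖v‖ ^ 2 * (2 * t)) t := by
    intro t
    have := ((hasDerivAt_comp_line hf x v t).sub
      ((hasDerivAt_id t).mul_const (inner ℝ (gradient f x) v))).sub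
      ((hasDerivAt_pow 2 t).const_mul (L / 2 * ‖v‖ ^ 2))
    exact this.congr_deriv (by simp)
  have hanti : AntitoneOn ψ (Icc 0 1) := by
    refine antitoneOn_of_deriv_nonpos (convex_Icc 0 1)
      (fun t _ => (hd t).continuousAt.continuousWithinAt)
      (fun t _ => (hd t).differentiableAt.differentiableWithinAt) fun t ht => ?_
    rw [interior_Icc] at ht
    rw [(hd t).deriv, ← inner_sub_left]
    have h1 := real_inner_le_norm (gradient f (x + t • v) - gradient f x) v
    have h2 := hL (x + t • v) x
    rw [add_sub_cancel_left, norm_smul, Real.norm_of_nonneg ht.1.le] at h2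
    nlinarith [mul_le_mul_of_nonneg_right h2 (norm_nonneg v)]
  have h := hanti (left_mem_Icc.2 zero_le_one) (right_mem_Icc.2 zero_le_one) zero_le_one
  simp only [ψ, one_smul, zero_smul, add_zero] at h
  have e : x + v = y := by rw [hv]; abel
  rw [e] at h
  linarith

/-- On the segment from `x` to `y` the convexified function lies above its tangent at `x`. Expanding
`‖y‖²` around `x` cancels the linear part of the added quadratic and leaves `-ρ/2 ‖y - x‖²`. -/
lemma quadLower_of_weaklyConvex {f : H → ℝ} (hf : Differentiable ℝ f) {ρ : ℝ}
    (hc : ConvexOn ℝ univ fun x => f x + ρ / 2 * ‖x‖ ^ 2) :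
    QuadLower f (gradient f) (-ρ) := by
  intro x y
  set v := y - x with hv
  have hline : ConvexOn ℝ univ (fun t : ℝ => f (x + t • v) + ρ / 2 * ‖x + t • v‖ ^ 2) := by
    have := hc.comp_affineMap (AffineMap.lineMap x y : ℝ →ᵃ[ℝ] H)
    simpa [AffineMap.lineMap_apply, Function.comp_def, add_comm, hv] using this
  have hd : HasDerivAt (fun t : ℝ => f (x + t • v) + ρ / 2 * ‖x + t • v‖ ^ 2)
      (inner ℝ (gradient f x) v + ρ * inner ℝ x v) 0 := by
    have h1 := hasDerivAt_comp_line hf x v 0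
    have h2 : HasDerivAt (fun t : ℝ => ‖x + t • v‖ ^ 2) (2 * inner ℝ x v) 0 := by
      have h3 : (fun t : ℝ => ‖x + t • v‖ ^ 2)
          = fun t : ℝ => ‖x‖ ^ 2 + t * (2 * inner ℝ x v) + ‖v‖ ^ 2 * t ^ 2 := by
        funext t
        rw [norm_add_sq_real, real_inner_smul_right, norm_smul, mul_pow, Real.norm_eq_abs, sq_abs]
        ring
      rw [h3]
      have := (((hasDerivAt_id (0 : ℝ)).mul_const (2 * inner ℝ x v)).const_add (‖x‖ ^ 2)).add
        ((hasDerivAt_pow 2 (0 : ℝ)).const_mul (‖v‖ ^ 2))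
      exact this.congr_deriv (by simp)
    have h4 := h1.add (h2.const_mul (ρ / 2))
    simp only [zero_smul, add_zero] at h4
    exact h4.congr_deriv (by ring)
  have h := hline.le_slope_of_hasDerivAt (mem_univ 0) (mem_univ 1) zero_lt_one hd
  simp only [slope_def_field, one_smul, zero_smul, add_zero, sub_zero, div_one] at h
  have e : x + v = y := by rw [hv]; abel
  rw [e] at h
  have h5 := half_sq_norm_expand x y
  rw [← hv] at h5
  have : ρ * (1 / 2 * ‖y‖ ^ 2) = ρ * (1 / 2 * ‖x‖ ^ 2 + inner ℝ x v + 1 / 2 * ‖v‖ ^ 2) := by rw [h5]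
  linarith

/-- A function with an upper quadratic model whose slope field is Lipschitz is differentiable, and
the slope field is its gradient. -/
lemma QuadUpper.hasGradientAt {f : H → ℝ} {f' : H → H} {M K : ℝ} (h : QuadUpper f f' M)
    (hK : ∀ x y, ‖f' x - f' y‖ ≤ K * ‖x - y‖) (x : H) : HasGradientAt f (f' x) x := by
  -- The model at `x` bounds the remainder above. The model at `y`, with `f' y` replaced by `f' x`
  -- at Lipschitz cost, bounds it below.
  have key : ∀ y, ‖f y - f x - inner ℝ (f' x) (y - x)‖ ≤ (|M| / 2 + |K|) * ‖y - x‖ ^ 2 := by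
    intro y
    have h1 := h x y
    have h2 := h y x
    have h3 : inner ℝ (f' y) (x - y) = -inner ℝ (f' x) (y - x) - inner ℝ (f' y - f' x) (y - x) := by
      rw [← neg_sub y x, inner_neg_right, inner_sub_left]; ring
    have h4 := abs_le.1 (abs_real_inner_le_norm (f' y - f' x) (y - x))
    have h5 := mul_le_mul_of_nonneg_right (hK y x) (norm_nonneg (y - x))
    have h6 : K * ‖y - x‖ * ‖y - x‖ ≤ |K| * ‖y - x‖ ^ 2 := by
      nlinarith [mul_le_mul_of_nonneg_right (le_abs_self K) (sq_nonneg ‖y - x‖)]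
    have h7 := mul_le_mul_of_nonneg_right (le_abs_self M) (sq_nonneg ‖y - x‖)
    have h8 := mul_nonneg (abs_nonneg K) (sq_nonneg ‖y - x‖)
    rw [norm_sub_rev x y] at h2
    rw [Real.norm_eq_abs, abs_le]
    constructor <;> nlinarith
  rw [hasGradientAt_iff_isLittleO]
  refine (Asymptotics.IsBigO.of_bound (|M| / 2 + |K|) (g := fun y => ‖y - x‖ ^ 2)
    (Eventually.of_forall fun y => ?_)).trans_isLittleO ?_
  · simpa using key y
  · have : (fun y => ‖y - x‖ ^ 2) =o[nhds x] fun y => ‖y - x‖ ^ 1 :=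
      (Asymptotics.isLittleO_pow_pow one_lt_two).comp_tendsto
        (by simpa using ((continuous_id.sub continuous_const).norm.tendsto x : Tendsto (fun y : H => ‖y - x‖) _ _))
    simpa using this

end Smooth

end S2FOBA

/-! ### Joint parameters and restriction to blocks -/

namespace S2FOBA

variable {ny nu : ℕ}

@[simp] lemma pair_fst (y : Vec ny) (u : Vec nu) : (pair y u).fst = y := rfl
@[simp] lemma pair_snd (y : Vec ny) (u : Vec nu) : (pair y u).snd = u := rfl
@[simp] lemma pair_eta (θ : Param ny nu) : pair θ.fst θ.snd = θ := rfl

lemma pair_sub (y y' : Vec ny) (u u' : Vec nu) :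
    pair y u - pair y' u' = pair (y - y') (u - u') := rfl

lemma inner_pair (θ : Param ny nu) (y : Vec ny) (u : Vec nu) :
    inner ℝ θ (pair y u) = inner ℝ θ.fst y + inner ℝ θ.snd u := by
  rw [WithLp.prod_inner_apply]; rfl

lemma norm_pair_sq (y : Vec ny) (u : Vec nu) : ‖pair y u‖ ^ 2 = ‖y‖ ^ 2 + ‖u‖ ^ 2 := by
  rw [WithLp.prod_norm_sq_eq_of_L2]; rfl

lemma norm_fst_le_param (θ : Param ny nu) : ‖θ.fst‖ ≤ ‖θ‖ := by
  refine le_of_sq_le_sq ?_ (norm_nonneg _)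
  rw [WithLp.prod_norm_sq_eq_of_L2]; nlinarith [sq_nonneg ‖θ.snd‖]

lemma norm_snd_le_param (θ : Param ny nu) : ‖θ.snd‖ ≤ ‖θ‖ := by
  refine le_of_sq_le_sq ?_ (norm_nonneg _)
  rw [WithLp.prod_norm_sq_eq_of_L2]; nlinarith [sq_nonneg ‖θ.fst‖]

lemma norm_pair_le (y : Vec ny) (u : Vec nu) : ‖pair y u‖ ≤ ‖y‖ + ‖u‖ := by
  refine le_of_sq_le_sq ?_ (by positivity)
  rw [norm_pair_sq]; nlinarith [mul_nonneg (norm_nonneg y) (norm_nonneg u)]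

lemma norm_pair_zero_right (y : Vec ny) : ‖pair y (0 : Vec nu)‖ = ‖y‖ := by
  rw [← sq_eq_sq₀ (norm_nonneg _) (norm_nonneg _), norm_pair_sq]; simp

lemma norm_pair_zero_left (u : Vec nu) : ‖pair (0 : Vec ny) u‖ = ‖u‖ := by
  rw [← sq_eq_sq₀ (norm_nonneg _) (norm_nonneg _), norm_pair_sq]; simp

/-- The algorithm moves one block at a time, so models are needed with the other block frozen; a
displacement inside one block has the same norm in the joint space. -/
lemma QuadUpper.section_fst {f : Param ny nu → ℝ} {f' : Param ny nu → Param ny nu} {M : ℝ}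
    (h : QuadUpper f f' M) (u : Vec nu) :
    QuadUpper (fun z => f (pair z u)) (fun z => (f' (pair z u)).fst) M := by
  intro x y
  have := h (pair x u) (pair y u)
  rwa [pair_sub, sub_self, inner_pair, inner_zero_right, add_zero, norm_pair_zero_right] at this

lemma QuadLower.section_fst {f : Param ny nu → ℝ} {f' : Param ny nu → Param ny nu} {m : ℝ}
    (h : QuadLower f f' m) (u : Vec nu) :
    QuadLower (fun z => f (pair z u)) (fun z => (f' (pair z u)).fst) m := by
  intro x y
  have := h (pair x u) (pair y u)
  rwa [pair_sub, sub_self, inner_pair, inner_zero_right, add_zero, norm_pair_zero_right] at this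

lemma QuadUpper.section_snd {f : Param ny nu → ℝ} {f' : Param ny nu → Param ny nu} {M : ℝ}
    (h : QuadUpper f f' M) (z : Vec ny) :
    QuadUpper (fun u => f (pair z u)) (fun u => (f' (pair z u)).snd) M := by
  intro x y
  have := h (pair z x) (pair z y)
  rwa [pair_sub, sub_self, inner_pair, inner_zero_right, zero_add, norm_pair_zero_left] at this

/-- The standing assumptions on the lower-level objective. -/
structure LowerLevel (e : Param ny nu → ℝ) (Le : ℝ≥0) (ρ γ : ℝ) : Prop where
  rho_pos : 0 < ρ
  weaklyConvex : IsWeaklyConvex ρ e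
  smooth : IsSmooth Le e
  gamma_pos : 0 < γ
  gamma_mul_rho_lt : γ * ρ < 1

/-- Strong convexity modulus of the proximal objective. -/
def modulus (ρ γ : ℝ) : ℝ := 1 / γ - ρ

/-- Gradient of the proximal objective. -/
def proxGrad (e : Param ny nu → ℝ) (γ : ℝ) (θ : Param ny nu) (z : Vec ny) : Vec ny :=
  gradY e (pair z θ.snd) + (1 / γ) • (z - θ.fst)

/-- Lipschitz constant of the proximal point. -/
def proxLip (Le : ℝ≥0) (ρ γ : ℝ) : ℝ := (Le + 1 / γ) / modulus ρ γ

/-- Gradient of the Moreau envelope. -/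
def moreauGrad (e : Param ny nu → ℝ) (γ : ℝ) (θ : Param ny nu) : Param ny nu :=
  pair ((1 / γ) • (θ.fst - prox e γ θ)) (gradU e (pair (prox e γ θ) θ.snd))

/-- Lipschitz constant of the gradient of the Moreau envelope. -/
def moreauLip (Le : ℝ≥0) (ρ γ : ℝ) : ℝ :=
  1 / γ * (1 + proxLip Le ρ γ) + Le * (proxLip Le ρ γ + 1)

lemma IsSmooth.norm_gradient_sub_le {L : ℝ≥0} {f : Param ny nu → ℝ} (h : IsSmooth L f)
    (x y : Param ny nu) : ‖gradient f x - gradient f y‖ ≤ L * ‖x - y‖ := h.2.norm_sub_le x y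

lemma norm_gradY_sub_le {L : ℝ≥0} {f : Param ny nu → ℝ} (h : IsSmooth L f)
    (x y : Param ny nu) : ‖gradY f x - gradY f y‖ ≤ L * ‖x - y‖ :=
  (norm_fst_le_param (gradient f x - gradient f y)).trans (h.norm_gradient_sub_le x y)

lemma norm_gradU_sub_le {L : ℝ≥0} {f : Param ny nu → ℝ} (h : IsSmooth L f)
    (x y : Param ny nu) : ‖gradU f x - gradU f y‖ ≤ L * ‖x - y‖ :=
  (norm_snd_le_param (gradient f x - gradient f y)).trans (h.norm_gradient_sub_le x y)

/-! ### Proximal point and Moreau envelope -/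

namespace LowerLevel

variable {e : Param ny nu → ℝ} {Le : ℝ≥0} {ρ γ : ℝ} (h : LowerLevel e Le ρ γ)
include h

lemma modulus_pos : 0 < modulus ρ γ := by
  have := h.gamma_pos
  have h2 := h.gamma_mul_rho_lt
  rw [modulus, sub_pos, lt_div_iff₀ this]; linarith

lemma proxLip_nonneg : 0 ≤ proxLip Le ρ γ := by
  have := h.modulus_pos
  have := h.gamma_pos
  unfold proxLip; positivity

lemma moreauLip_nonneg : 0 ≤ moreauLip Le ρ γ := by
  have := h.proxLip_nonneg
  have := h.gamma_pos
  unfold moreauLip; positivity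

lemma quadUpper : QuadUpper e (gradient e) Le :=
  quadUpper_of_lipschitz h.smooth.1 h.smooth.norm_gradient_sub_le

lemma quadLower : QuadLower e (gradient e) (-ρ) :=
  quadLower_of_weaklyConvex h.smooth.1 h.weaklyConvex

omit h in
lemma proxObj_eq (θ : Param ny nu) :
    proxObj e γ θ = fun z => e (pair z θ.snd) + (1 / γ) / 2 * ‖z - θ.fst‖ ^ 2 := by
  funext z
  rw [proxObj, mul_comm 2 γ, ← div_div]

lemma proxObj_quadUpper (θ : Param ny nu) :
    QuadUpper (proxObj e γ θ) (proxGrad e γ θ) (Le + 1 / γ) := by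
  rw [proxObj_eq]
  exact (h.quadUpper.section_fst θ.snd).add_sq (1 / γ) θ.fst

lemma proxObj_quadLower (θ : Param ny nu) :
    QuadLower (proxObj e γ θ) (proxGrad e γ θ) (modulus ρ γ) := by
  rw [proxObj_eq, modulus, sub_eq_neg_add]
  exact (h.quadLower.section_fst θ.snd).add_sq (1 / γ) θ.fst

lemma proxObj_continuous (θ : Param ny nu) : Continuous (proxObj e γ θ) := by
  have h1 : Continuous fun z : Vec ny => pair z θ.snd :=
    (WithLp.prod_continuous_toLp 2 _ _).comp (continuous_id.prodMk continuous_const)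
  have h2 : Continuous fun z : Vec ny => e (pair z θ.snd) := (continuous_of_differentiable h.smooth.1).comp h1
  exact h2.add (continuous_const.mul ((continuous_id.sub continuous_const).norm.pow 2))

/-- By the upper model, a step of length `1/M` along `-g` lowers the objective by at least
`‖g‖²/(2M)`, which minimality forbids unless `g = 0`. -/
lemma proxGrad_eq_zero_of_isMinOn {θ : Param ny nu} {z : Vec ny}
    (hz : IsMinOn (proxObj e γ θ) univ z) : proxGrad e γ θ z = 0 := by
  have hM : 0 < (Le : ℝ) + 1 / γ := by have := h.gamma_pos; positivity
  set M := (Le : ℝ) + 1 / γ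
  set g := proxGrad e γ θ z with hg
  have h1 := h.proxObj_quadUpper θ z (z - (1 / M) • g)
  have h2 := isMinOn_iff.1 hz (z - (1 / M) • g) (mem_univ _)
  have e2 : z - (1 / M) • g - z = -((1 / M) • g) := by abel
  rw [e2, ← hg, inner_neg_right, real_inner_smul_right, norm_neg, norm_smul, mul_pow,
    real_inner_self_eq_norm_sq] at h1
  have h4 : ‖1 / M‖ ^ 2 = 1 / M ^ 2 := by simp
  have h5 : M / 2 * (1 / M ^ 2 * ‖g‖ ^ 2) = 1 / (2 * M) * ‖g‖ ^ 2 := by field_simp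
  have h6 : 1 / M * ‖g‖ ^ 2 = 2 * (1 / (2 * M) * ‖g‖ ^ 2) := by field_simp
  change _ ≤ _ + _ + M / 2 * _ at h1
  rw [h4, h5, h6] at h1
  have h7 : 1 / (2 * M) * ‖g‖ ^ 2 ≤ 0 := by linarith
  have h8 : ‖g‖ ^ 2 ≤ 0 := by
    by_contra hc
    have : 0 < 1 / (2 * M) * ‖g‖ ^ 2 := mul_pos (by positivity) (not_le.1 hc)
    linarith
  exact norm_eq_zero.1 (pow_eq_zero_iff two_ne_zero |>.1 (le_antisymm h8 (sq_nonneg _)))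

lemma exists_isMinOn (θ : Param ny nu) : ∃ z, IsMinOn (proxObj e γ θ) univ z := by
  have hm := h.modulus_pos
  have hev : ∀ᶠ z in cocompact (Vec ny), proxObj e γ θ 0 ≤ proxObj e γ θ z := by
    have := tendsto_norm_cocompact_atTop (E := Vec ny)
    -- The lower model at `0` exceeds its value there by at least `‖z‖ (m ‖z‖ / 2 - ‖proxGrad e γ θ
    -- 0‖)`, which is nonnegative beyond this radius.
    filter_upwards [this.eventually_ge_atTop (2 * ‖proxGrad e γ θ 0‖ / modulus ρ γ)] with z hz
    have h1 := h.proxObj_quadLower θ 0 z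
    rw [sub_zero] at h1
    have h2 := (abs_le.1 (abs_real_inner_le_norm (proxGrad e γ θ 0) z)).1
    rw [div_le_iff₀ hm] at hz
    nlinarith [mul_le_mul_of_nonneg_right hz (norm_nonneg z)]
  obtain ⟨z, hz⟩ := (h.proxObj_continuous θ).exists_forall_le' 0 hev
  exact ⟨z, isMinOn_iff.2 fun x _ => hz x⟩

lemma prox_isMinOn (θ : Param ny nu) : IsMinOn (proxObj e γ θ) univ (prox e γ θ) :=
  Classical.epsilon_spec (h.exists_isMinOn θ)

lemma proxGrad_prox (θ : Param ny nu) : proxGrad e γ θ (prox e γ θ) = 0 :=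
  h.proxGrad_eq_zero_of_isMinOn (h.prox_isMinOn θ)

lemma existsUnique_isMinOn (θ : Param ny nu) : ∃! z, IsMinOn (proxObj e γ θ) univ z := by
  refine ⟨prox e γ θ, h.prox_isMinOn θ, fun z hz => ?_⟩
  have h1 := (h.proxObj_quadLower θ).strong_monotone z (prox e γ θ)
  rw [h.proxGrad_prox, h.proxGrad_eq_zero_of_isMinOn hz, sub_zero, inner_zero_left] at h1
  have h2 : ‖z - prox e γ θ‖ ^ 2 ≤ 0 := by
    by_contra hc
    have := mul_pos h.modulus_pos (not_le.1 hc)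
    linarith
  exact sub_eq_zero.1 (norm_eq_zero.1 (pow_eq_zero_iff two_ne_zero |>.1
    (le_antisymm h2 (sq_nonneg _))))

/-- Strong monotonicity bounds `m ‖z - z'‖` by the residual at `z'` of the optimality condition for
`θ`. Since `z'` solves the condition for `θ'`, this residual is a difference in `θ` alone, of size
at most `(Le + 1/γ) ‖θ - θ'‖`. -/
lemma norm_prox_sub_le (θ θ' : Param ny nu) :
    ‖prox e γ θ - prox e γ θ'‖ ≤ proxLip Le ρ γ * ‖θ - θ'‖ := by
  have hm := h.modulus_pos
  have hγ := h.gamma_pos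
  set z := prox e γ θ
  set z' := prox e γ θ'
  have h1 := (h.proxObj_quadLower θ).strong_monotone z z'
  rw [h.proxGrad_prox, zero_sub] at h1
  have h2 : -proxGrad e γ θ z' = (gradY e (pair z' θ'.snd) - gradY e (pair z' θ.snd))
      + (1 / γ) • (θ.fst - θ'.fst) := by
    have := h.proxGrad_prox θ'
    change proxGrad e γ θ' z' = 0 at this
    rw [← sub_zero (-proxGrad e γ θ z'), ← neg_eq_zero.2 this]
    simp only [proxGrad]; module
  have h3 : ‖-proxGrad e γ θ z'‖ ≤ (Le + 1 / γ) * ‖θ - θ'‖ := by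
    rw [h2]
    refine (norm_add_le _ _).trans ?_
    have a1 := norm_gradY_sub_le h.smooth (pair z' θ'.snd) (pair z' θ.snd)
    rw [pair_sub, sub_self, norm_pair_zero_left, norm_sub_rev θ'.snd] at a1
    have a2 := norm_snd_le_param (θ - θ')
    have a3 := norm_fst_le_param (θ - θ')
    rw [WithLp.sub_snd] at a2
    rw [WithLp.sub_fst] at a3
    rw [norm_smul, Real.norm_of_nonneg (by positivity), add_mul]
    gcongr
    exact a1.trans (by gcongr)
  have h4 := (h1.trans (real_inner_le_norm _ _)).trans
    (mul_le_mul_of_nonneg_right h3 (norm_nonneg _))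
  rw [proxLip, div_mul_eq_mul_div, le_div_iff₀ hm]
  rcases (norm_nonneg (z - z')).eq_or_lt with h0 | h0
  · rw [← h0, zero_mul]; positivity
  · refine le_of_mul_le_mul_right ?_ h0
    nlinarith [sq ‖z - z'‖, mul_assoc ‖z - z'‖ (modulus ρ γ) ‖z - z'‖]

lemma prox_continuous : Continuous (prox e γ) :=
  (LipschitzWith.of_dist_le_mul (K := ⟨_, h.proxLip_nonneg⟩) fun x y => by
    rw [dist_eq_norm, dist_eq_norm]; exact h.norm_prox_sub_le x y).continuous

lemma moreau_eq (θ : Param ny nu) : moreau e γ θ = proxObj e γ θ (prox e γ θ) := by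
  have hz := fun x => isMinOn_iff.1 (h.prox_isMinOn θ) x (mem_univ _)
  exact le_antisymm (ciInf_le ⟨_, by rintro _ ⟨x, rfl⟩; exact hz x⟩ _) (le_ciInf hz)

lemma moreau_le (θ : Param ny nu) (z : Vec ny) : moreau e γ θ ≤ proxObj e γ θ z := by
  rw [h.moreau_eq]; exact isMinOn_iff.1 (h.prox_isMinOn θ) z (mem_univ _)

lemma moreau_le_self (θ : Param ny nu) : moreau e γ θ ≤ e θ := by
  simpa [proxObj] using h.moreau_le θ θ.fst

/-- The proximal point of `θ` is an admissible competitor at `θ'` and is exact at `θ`. With `z`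
frozen, the objective has curvature `1/γ` in the first block and at most `Le` in the second; the sum
covers both. -/
lemma moreau_quadUpper : QuadUpper (moreau e γ) (moreauGrad e γ) (Le + 1 / γ) := by
  intro θ θ'
  have h0 := h.moreau_le θ' (prox e γ θ)
  rw [h.moreau_eq θ]
  set z := prox e γ θ
  have h1 := h.quadUpper.section_snd z θ.snd θ'.snd
  have h2 := half_sq_norm_expand (θ.fst - z) (θ'.fst - z)
  rw [sub_sub_sub_cancel_right] at h2
  have h3 : inner ℝ (moreauGrad e γ θ) (θ' - θ) = 1 / γ * inner ℝ (θ.fst - z) (θ'.fst - θ.fst)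
      + inner ℝ (gradient e (pair z θ.snd)).snd (θ'.snd - θ.snd) := by
    rw [WithLp.prod_inner_apply, ← real_inner_smul_left]; rfl
  have h4 : ‖θ' - θ‖ ^ 2 = ‖θ'.fst - θ.fst‖ ^ 2 + ‖θ'.snd - θ.snd‖ ^ 2 := by
    rw [WithLp.prod_norm_sq_eq_of_L2]; rfl
  have h5 : (1 / γ) * (1 / 2 * ‖θ'.fst - z‖ ^ 2) = (1 / γ) * (1 / 2 * ‖θ.fst - z‖ ^ 2
    + inner ℝ (θ.fst - z) (θ'.fst - θ.fst) + 1 / 2 * ‖θ'.fst - θ.fst‖ ^ 2) := by rw [h2]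
  rw [proxObj_eq] at h0 ⊢
  simp only [norm_sub_rev z] at h0 ⊢
  rw [h3, h4]
  have hγ : 0 ≤ 1 / γ := by have := h.gamma_pos; positivity
  have := mul_nonneg hγ (sq_nonneg ‖θ'.snd - θ.snd‖)
  have := mul_nonneg Le.coe_nonneg (sq_nonneg ‖θ'.fst - θ.fst‖)
  linarith

lemma norm_moreauGrad_sub_le (θ θ' : Param ny nu) :
    ‖moreauGrad e γ θ - moreauGrad e γ θ'‖ ≤ moreauLip Le ρ γ * ‖θ - θ'‖ := by
  have hγ : 0 ≤ 1 / γ := by have := h.gamma_pos; positivity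
  have hp := h.norm_prox_sub_le θ θ'
  rw [moreauGrad, moreauGrad, pair_sub]
  refine (norm_pair_le _ _).trans ?_
  rw [← smul_sub, norm_smul, Real.norm_of_nonneg hγ, moreauLip, add_mul, mul_assoc, mul_assoc]
  have a2 := norm_snd_le_param (θ - θ')
  have a3 := norm_fst_le_param (θ - θ')
  rw [WithLp.sub_snd] at a2
  rw [WithLp.sub_fst] at a3
  gcongr
  · rw [sub_sub_sub_comm]
    refine (norm_sub_le _ _).trans ?_
    linarith
  · refine (norm_gradU_sub_le h.smooth _ _).trans ?_
    gcongr
    rw [pair_sub]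
    refine (norm_pair_le _ _).trans ?_
    linarith

/-- An envelope theorem that needs no derivative of the proximal point: an upper model together with
a Lipschitz slope field suffices. -/
lemma moreau_hasGradientAt (θ : Param ny nu) :
    HasGradientAt (moreau e γ) (moreauGrad e γ θ) θ :=
  h.moreau_quadUpper.hasGradientAt h.norm_moreauGrad_sub_le θ

/-- One gradient step on the proximal objective contracts the distance to the proximal point. -/
lemma norm_proxGrad_step_sub_prox_sq_le {η : ℝ} (hη : 0 ≤ η) (hη' : η * (Le + 2 / γ - ρ) ≤ 2)
    (θ : Param ny nu) (z : Vec ny) :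
    ‖z - η • proxGrad e γ θ z - prox e γ θ‖ ^ 2
      ≤ (1 - η * modulus ρ γ) * ‖z - prox e γ θ‖ ^ 2 := by
  have hmM : modulus ρ γ < Le + 1 / γ := by
    have := h.rho_pos
    have := Le.coe_nonneg
    unfold modulus; linarith
  have := gradient_step_contraction h.modulus_pos.le hmM (h.proxObj_quadLower θ)
    (h.proxObj_quadUpper θ) hη (by
      -- The sum of the upper and lower curvatures: this is the origin of the upper bound imposed on
      -- `η₀`.
      have : (Le : ℝ) + 1 / γ + modulus ρ γ = Le + 2 / γ - ρ := by unfold modulus; ring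
      rwa [this]) z (prox e γ θ)
  rwa [h.proxGrad_prox, smul_zero, sub_zero] at this

end LowerLevel

/-! ### The penalized objective -/

section Phi

variable {j e : Param ny nu → ℝ} {Lj Le : ℝ≥0} {ρ γ : ℝ}

lemma phi_hasGradientAt (h : LowerLevel e Le ρ γ) (hj : IsSmooth Lj j) (c : ℝ)
    (θ : Param ny nu) : HasGradientAt (phi j e γ c)
      ((1 / c) • gradient j θ + (gradient e θ - moreauGrad e γ θ)) θ := by
  rw [hasGradientAt_iff_hasFDerivAt, map_add, map_sub, map_smul]
  have h1 := (hj.1 θ).hasGradientAt.hasFDerivAt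
  have h2 := (h.smooth.1 θ).hasGradientAt.hasFDerivAt
  exact ((h1.sub_const _).const_mul (1 / c)).add (h2.sub (h.moreau_hasGradientAt θ).hasFDerivAt)

lemma phi_differentiable (h : LowerLevel e Le ρ γ) (hj : IsSmooth Lj j) (c : ℝ) :
    Differentiable ℝ (phi j e γ c) :=
  fun θ => (phi_hasGradientAt h hj c θ).differentiableAt

lemma gradient_phi (h : LowerLevel e Le ρ γ) (hj : IsSmooth Lj j) (c : ℝ)
    (θ : Param ny nu) : gradient (phi j e γ c) θ
      = (1 / c) • gradient j θ + (gradient e θ - moreauGrad e γ θ) :=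
  (phi_hasGradientAt h hj c θ).gradient

lemma gradY_phi (h : LowerLevel e Le ρ γ) (hj : IsSmooth Lj j) (c : ℝ) (θ : Param ny nu) :
    gradY (phi j e γ c) θ
      = (1 / c) • gradY j θ + (gradY e θ - (1 / γ) • (θ.fst - prox e γ θ)) := by
  rw [gradY, gradient_phi h hj]; rfl

lemma gradU_phi (h : LowerLevel e Le ρ γ) (hj : IsSmooth Lj j) (c : ℝ) (θ : Param ny nu) :
    gradU (phi j e γ c) θ
      = (1 / c) • gradU j θ + (gradU e θ - gradU e (pair (prox e γ θ) θ.snd)) := by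
  rw [gradU, gradient_phi h hj]; rfl

/-- Lipschitz constant of the gradients of `phi j e γ c` for `c ≥ c₀`. -/
def phiLip (Lj Le : ℝ≥0) (ρ γ c₀ : ℝ) : ℝ := Lj / c₀ + (Le + moreauLip Le ρ γ)

lemma phiLip_nonneg (h : LowerLevel e Le ρ γ) {c₀ : ℝ} (hc₀ : 0 < c₀) :
    0 ≤ phiLip Lj Le ρ γ c₀ := by
  have := h.moreauLip_nonneg
  unfold phiLip; positivity

lemma norm_gradient_phi_sub_le (h : LowerLevel e Le ρ γ) (hj : IsSmooth Lj j) {c₀ c : ℝ}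
    (hc₀ : 0 < c₀) (hc : c₀ ≤ c) (θ θ' : Param ny nu) :
    ‖gradient (phi j e γ c) θ - gradient (phi j e γ c) θ'‖
      ≤ phiLip Lj Le ρ γ c₀ * ‖θ - θ'‖ := by
  rw [gradient_phi h hj, gradient_phi h hj, add_sub_add_comm, ← smul_sub, sub_sub_sub_comm]
  refine (norm_add_le _ _).trans ?_
  have h1 := hj.norm_gradient_sub_le θ θ'
  have h2 := h.smooth.norm_gradient_sub_le θ θ'
  have h3 := h.norm_moreauGrad_sub_le θ θ'
  have hcpos : 0 < c := hc₀.trans_le hc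
  have h4 : ‖(1 / c) • (gradient j θ - gradient j θ')‖ ≤ Lj / c₀ * ‖θ - θ'‖ := by
    rw [norm_smul, Real.norm_of_nonneg (by positivity), div_mul_eq_mul_div,
      div_mul_eq_mul_div, one_mul]
    exact div_le_div₀ (by positivity) h1 hc₀ hc
  have h5 := norm_sub_le (gradient e θ - gradient e θ') (moreauGrad e γ θ - moreauGrad e γ θ')
  rw [phiLip]; linarith

lemma phi_quadUpper (h : LowerLevel e Le ρ γ) (hj : IsSmooth Lj j) {c₀ c : ℝ}
    (hc₀ : 0 < c₀) (hc : c₀ ≤ c) :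
    QuadUpper (phi j e γ c) (gradient (phi j e γ c)) (phiLip Lj Le ρ γ c₀) :=
  quadUpper_of_lipschitz (phi_differentiable h hj c) (norm_gradient_phi_sub_le h hj hc₀ hc)

lemma phi_nonneg (h : LowerLevel e Le ρ γ) (hj_bdd : BddBelow (range j)) {c : ℝ} (hc : 0 < c)
    (θ : Param ny nu) : 0 ≤ phi j e γ c θ := by
  have h1 := h.moreau_le_self θ
  have h2 : ⨅ θ', j θ' ≤ j θ := ciInf_le hj_bdd θ
  exact add_nonneg (mul_nonneg (by positivity) (by linarith)) (by linarith)

/-- The weight `1/c` multiplies the nonnegative gap `j - inf j`. This allows `c_k` to be replaced by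
`c_{k+1}` in the merit function at no cost. -/
lemma phi_anti (hj_bdd : BddBelow (range j)) {c c' : ℝ} (hc : 0 < c) (hcc' : c ≤ c')
    (θ : Param ny nu) : phi j e γ c' θ ≤ phi j e γ c θ := by
  have h2 : ⨅ θ', j θ' ≤ j θ := ciInf_le hj_bdd θ
  exact add_le_add_left (mul_le_mul_of_nonneg_right (one_div_le_one_div_of_le hc hcc')
    (by linarith)) _

end Phi

end S2FOBA

/-! ### Conditionally centred noise -/

namespace S2FOBA

lemma _root_.MeasureTheory.MemLp.integrable_norm_sq {Ω E : Type*}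
    {mΩ : MeasurableSpace Ω} {μ : Measure Ω} [NormedAddCommGroup E] {X : Ω → E} (h : MemLp X 2 μ) :
    Integrable (fun ω => ‖X ω‖ ^ 2) μ :=
  (memLp_two_iff_integrable_sq_norm h.1).1 h

/-- `N` is square integrable and centred conditionally on `𝒢`. -/
structure IsNoise {Ω H : Type*} {mΩ : MeasurableSpace Ω} [NormedAddCommGroup H]
    [InnerProductSpace ℝ H] [CompleteSpace H] (μ : Measure Ω) (𝒢 : MeasurableSpace Ω) (N : Ω → H) : Prop where
  memLp : MemLp N 2 μ
  condExp_eq_zero : μ[N | 𝒢] =ᵐ[μ] 0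

section Noise

variable {Ω : Type*} {mΩ : MeasurableSpace Ω} {μ : Measure Ω} {𝒢 : MeasurableSpace Ω}
  {H : Type*} [NormedAddCommGroup H] [InnerProductSpace ℝ H]

lemma _root_.MeasureTheory.MemLp.integrable_real_inner {X Y : Ω → H} (hX : MemLp X 2 μ)
    (hY : MemLp Y 2 μ) : Integrable (fun ω => (inner ℝ (X ω) (Y ω) : ℝ)) μ := by
  refine (hX.integrable_norm_sq.add hY.integrable_norm_sq).mono' (hX.1.inner hY.1)
    (Eventually.of_forall fun ω => ?_)
  have := norm_inner_le_norm (𝕜 := ℝ) (X ω) (Y ω)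
  simp only [Pi.add_apply]
  nlinarith [sq_nonneg (‖X ω‖ - ‖Y ω‖), sq_nonneg ‖X ω‖, sq_nonneg ‖Y ω‖]

variable [CompleteSpace H]

lemma IsNoise.add [IsFiniteMeasure μ] {N N' : Ω → H} (h : IsNoise μ 𝒢 N) (h' : IsNoise μ 𝒢 N') :
    IsNoise μ 𝒢 (fun ω => N ω + N' ω) := by
  refine ⟨h.memLp.add h'.memLp, ?_⟩
  refine (condExp_add (h.memLp.integrable one_le_two) (h'.memLp.integrable one_le_two) 𝒢).trans ?_
  filter_upwards [h.condExp_eq_zero, h'.condExp_eq_zero] with ω h1 h2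
  simp [h1, h2]

lemma IsNoise.const_smul {N : Ω → H} (h : IsNoise μ 𝒢 N) (r : ℝ) :
    IsNoise μ 𝒢 (fun ω => r • N ω) := by
  refine ⟨h.memLp.const_smul r, ?_⟩
  refine (condExp_smul r N 𝒢).trans ?_
  filter_upwards [h.condExp_eq_zero] with ω h1
  simp [h1]

/-- The `𝒢`-measurable factor is pulled out of the conditional expectation, and what remains
vanishes. -/
lemma IsNoise.integral_inner_eq_zero [IsFiniteMeasure μ] (hm : 𝒢 ≤ mΩ) {X N : Ω → H}
    (hN : IsNoise μ 𝒢 N) (hX : MemLp X 2 μ) (hXm : StronglyMeasurable[𝒢] X) :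
    ∫ ω, inner ℝ (X ω) (N ω) ∂μ = 0 := by
  have h1 := condExp_bilin_of_stronglyMeasurable_left (m := 𝒢) (μ := μ) (innerSL ℝ) hXm
    (hX.integrable_real_inner hN.memLp) (hN.memLp.integrable one_le_two)
  rw [← integral_condExp hm]
  refine integral_eq_zero_of_ae (h1.trans ?_)
  filter_upwards [hN.condExp_eq_zero] with ω h2
  simp [h2]

lemma IsNoise.integral_norm_add_sq [IsFiniteMeasure μ] (hm : 𝒢 ≤ mΩ) {X N : Ω → H}
    (hN : IsNoise μ 𝒢 N) (hX : MemLp X 2 μ) (hXm : StronglyMeasurable[𝒢] X) :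
    ∫ ω, ‖X ω + N ω‖ ^ 2 ∂μ = ∫ ω, ‖X ω‖ ^ 2 ∂μ + ∫ ω, ‖N ω‖ ^ 2 ∂μ := by
  simp only [norm_add_sq_real]
  have i1 := hX.integrable_norm_sq
  have i2 := (hX.integrable_real_inner hN.memLp).const_mul 2
  have i3 := hN.memLp.integrable_norm_sq
  have e1 := integral_add (i1.add i2) i3
  simp only [Pi.add_apply] at e1
  rw [e1, integral_add i1 i2, integral_const_mul, hN.integral_inner_eq_zero hm hX hXm]
  ring

/-- Descent in expectation for a step along a biased and noisy gradient `X + N` of slope `a`. -/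
lemma IsNoise.expected_descent [IsFiniteMeasure μ] (hm : 𝒢 ≤ mΩ) {P P' : Ω → ℝ} {a X N : Ω → H}
    {α L : ℝ} (hN : IsNoise μ 𝒢 N) (hX : MemLp X 2 μ) (hXm : StronglyMeasurable[𝒢] X)
    (ha : MemLp a 2 μ) (ham : StronglyMeasurable[𝒢] a) (hP : Integrable P μ)
    (hP' : Integrable P' μ)
    (hle : ∀ ω, P' ω ≤ P ω - α * inner ℝ (a ω) (X ω + N ω) + L / 2 * α ^ 2 * ‖X ω + N ω‖ ^ 2) :
    ∫ ω, P' ω ∂μ ≤ ∫ ω, P ω ∂μ - α / 2 * (∫ ω, ‖a ω‖ ^ 2 ∂μ + ∫ ω, ‖X ω‖ ^ 2 ∂μ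
        - ∫ ω, ‖X ω - a ω‖ ^ 2 ∂μ)
      + L / 2 * α ^ 2 * (∫ ω, ‖X ω‖ ^ 2 ∂μ + ∫ ω, ‖N ω‖ ^ 2 ∂μ) := by
  have i1 := ha.integrable_norm_sq
  have i2 := hX.integrable_norm_sq
  have i3 := (hX.sub ha).integrable_norm_sq
  have i4 := ha.integrable_real_inner hN.memLp
  have i5 := (hX.add hN.memLp).integrable_norm_sq
  simp only [Pi.sub_apply, Pi.add_apply] at i3 i5
  have j1 : Integrable (fun ω => α / 2 * (‖a ω‖ ^ 2 + ‖X ω‖ ^ 2 - ‖X ω - a ω‖ ^ 2)) μ :=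
    ((i1.add i2).sub i3).const_mul _
  have j2 := i4.const_mul α
  have j3 := i5.const_mul (L / 2 * α ^ 2)
  -- Polarization of `⟨a, X⟩`. The term `-α/2 ‖X‖²` is kept because it later absorbs the
  -- second-order terms in `‖X‖²`.
  have hle' : ∀ ω, P' ω ≤ P ω - α / 2 * (‖a ω‖ ^ 2 + ‖X ω‖ ^ 2 - ‖X ω - a ω‖ ^ 2)
      - α * inner ℝ (a ω) (N ω) + L / 2 * α ^ 2 * ‖X ω + N ω‖ ^ 2 := by
    intro ω
    refine (hle ω).trans (le_of_eq ?_)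
    rw [norm_sub_sq_real, inner_add_right, real_inner_comm (X ω)]
    ring
  have key := integral_mono hP' (((hP.sub j1).sub j2).add j3) hle'
  refine key.trans (le_of_eq ?_)
  have e1 := integral_add ((hP.sub j1).sub j2) j3
  have e2 := integral_sub (hP.sub j1) j2
  have e3 := integral_sub hP j1
  have e4 := integral_sub (i1.add i2) i3
  have e5 := integral_add i1 i2
  simp only [Pi.sub_apply, Pi.add_apply] at e1 e2 e3 e4 e5 ⊢
  rw [e1, e2, e3, integral_const_mul, integral_const_mul, integral_const_mul, e4, e5,
    hN.integral_norm_add_sq hm hX hXm, hN.integral_inner_eq_zero hm ha ham]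
  ring

lemma memLp_two_of_lipschitz [IsFiniteMeasure μ] {E F : Type*} [NormedAddCommGroup E]
    [NormedAddCommGroup F] {f : E → F} {K : ℝ} (hf : Continuous f)
    (hK : ∀ x y, ‖f x - f y‖ ≤ K * ‖x - y‖) {X : Ω → E} (hX : MemLp X 2 μ) :
    MemLp (fun ω => f (X ω)) 2 μ := by
  have h1 : MemLp (fun ω => K * ‖X ω‖ + ‖f 0‖) 2 μ := (hX.norm.const_mul K).add (memLp_const _)
  refine h1.mono (hf.comp_aestronglyMeasurable hX.1) (Eventually.of_forall fun ω => ?_)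
  have h2 := hK (X ω) 0
  rw [sub_zero] at h2
  have h3 := norm_le_norm_sub_add (f (X ω)) (f 0)
  exact (h3.trans (by linarith)).trans (le_abs_self _)

end Noise

lemma IsUnbiasedOracle.isNoise {Ω : Type*} {mΩ : MeasurableSpace Ω} {n : ℕ} {μ : Measure Ω}
    [IsFiniteMeasure μ] {𝒢 : MeasurableSpace Ω} (hm : 𝒢 ≤ mΩ) {h g : Ω → Vec n} {σ : ℝ}
    (ho : IsUnbiasedOracle μ 𝒢 h g σ) (hg : MemLp g 2 μ) (hgm : StronglyMeasurable[𝒢] g) :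
    IsNoise μ 𝒢 (fun ω => h ω - g ω) := by
  refine ⟨(memLp_two_iff_integrable_sq_norm (ho.integrable.1.sub hg.1)).2 ho.integrable_sq, ?_⟩
  refine (condExp_sub ho.integrable (hg.integrable one_le_two) 𝒢).trans ?_
  rw [condExp_of_stronglyMeasurable hm hgm (hg.integrable one_le_two)]
  filter_upwards [ho.unbiased] with ω h1
  simp [h1]

lemma IsUnbiasedOracle.integral_sq_le {Ω : Type*} {mΩ : MeasurableSpace Ω} {n : ℕ} {μ : Measure Ω}
    [IsProbabilityMeasure μ] {𝒢 : MeasurableSpace Ω} (hm : 𝒢 ≤ mΩ) {h g : Ω → Vec n} {σ : ℝ}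
    (ho : IsUnbiasedOracle μ 𝒢 h g σ) : ∫ ω, ‖h ω - g ω‖ ^ 2 ∂μ ≤ σ ^ 2 := by
  rw [← integral_condExp hm]
  refine (integral_mono_ae integrable_condExp (integrable_const _) ho.variance_le).trans ?_
  simp

end S2FOBA

/-! ### Constants and arithmetic of the one-step estimate -/

namespace S2FOBA

section Constants

/-- Coefficient of the drift of the proximal point in the one-step estimate. -/
def driftConst (Le : ℝ≥0) (ρ γ η₀ : ℝ) : ℝ :=
  Cz Le ρ γ * (η₀ + 2 / modulus ρ γ) * proxLip Le ρ γ ^ 2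

/-- Bound on the step sizes `α₀` and `β₀`. -/
def stepBound (Lj Le : ℝ≥0) (ρ γ η₀ c₀ : ℝ) : ℝ :=
  min 1 (min
    (1 / 2 / (phiLip Lj Le ρ γ c₀ / 2 + Le ^ 2 * proxLip Le ρ γ ^ 2
      + driftConst Le ρ γ η₀ / η₀ + 1))
    (Cz Le ρ γ * modulus ρ γ * η₀ / 2 / (1 / γ ^ 2 / 2 + Le ^ 2)))

/-- Ratio between the variance of the update directions and `σj² + σe²`. -/
def varConst (γ η₀ c₀ : ℝ) : ℝ := 3 * (1 / c₀ ^ 2 + 2 + η₀ ^ 2 / γ ^ 2)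

/-- Coefficient of the noise in the descent estimate. -/
def noiseConst (Lj Le : ℝ≥0) (ρ γ η₀ c₀ : ℝ) : ℝ :=
  (Cz Le ρ γ * (1 + η₀ * modulus ρ γ / 2) + Le ^ 2)
    + (η₀ * (Le ^ 2 * proxLip Le ρ γ ^ 2 + phiLip Lj Le ρ γ c₀ / 2) + driftConst Le ρ γ η₀)
      * varConst γ η₀ c₀

/-- The letters stand for expectations. `P₀, P₁, P₂` are `φ_c` before, between and after the two
half steps. `D, B, X, W` are squared tracking errors: initially, after a noise-free `z`-step, after
the noisy one, and after `θ` has moved. `A`, `M`, `N` with index `y` or `u` are squared norms of the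
gradient, of the direction without noise, and of the noise; `g * B` and `Bu` are the squared biases,
and `Nz` is the noise of the `z`-step. In the sum `P₂ + C W` the `M` terms are absorbed by the
descent, the `B` terms by the contraction, and only noise remains. -/
lemma merit_descent_arith {m L ℓ Q C l g η₀ δ α β η κ s P₀ P₁ P₂ W X B D Ay My Ny Au Mu Nu Bu Nz : ℝ}
    (hm : 0 < m) (hL : 0 ≤ L) (hC : 0 ≤ C) (hl : 0 ≤ l) (hg : 0 ≤ g)
    (hη : 0 < η) (hηη₀ : η ≤ η₀) (hα : 0 ≤ α) (hβ : 0 ≤ β) (hαδ : α ≤ δ) (hβδ : β ≤ δ)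
    (hαη : α * η₀ ≤ δ * η) (hβη : β * η₀ ≤ δ * η) (hδ : δ ≤ 1)
    (hQ : Q = C * (η₀ + 2 / m) * ℓ ^ 2)
    (hδ₁ : δ * (L / 2 + l * ℓ ^ 2 + Q / η₀) ≤ 1 / 2) (hδ₂ : δ * (g / 2 + l) ≤ C * m * η₀ / 2)
    (hκ : 0 ≤ κ) (hs : 0 ≤ s)
    (hB₀ : 0 ≤ B) (hMy : 0 ≤ My) (hNy : 0 ≤ Ny) (hMu : 0 ≤ Mu) (hNu : 0 ≤ Nu)
    (hD : 0 ≤ D) (hNz₀ : 0 ≤ Nz) (hNz : Nz ≤ s) (hNys : Ny ≤ κ * s) (hNus : Nu ≤ κ * s)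
    (h₁ : P₁ ≤ P₀ - α / 2 * (Ay + My - g * B) + L / 2 * α ^ 2 * (My + Ny))
    (h₂ : P₂ ≤ P₁ - β / 2 * (Au + Mu - Bu) + L / 2 * β ^ 2 * (Mu + Nu))
    (hX : X = B + η ^ 2 * Nz)
    (hW : W ≤ (1 + η * m / 2) * X
      + (1 + 2 / (η * m)) * ℓ ^ 2 * (α ^ 2 * (My + Ny) + β ^ 2 * (Mu + Nu)))
    (hB : B ≤ (1 - η * m) * D)
    (hBu : Bu ≤ 2 * l * (X + ℓ ^ 2 * α ^ 2 * (My + Ny))) :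
    P₂ + C * W + α / 2 * Ay + β / 2 * Au ≤ P₀ + C * D
      + (α ^ 2 / η + β ^ 2 / η + η ^ 2)
        * ((C * (1 + η₀ * m / 2) + l) + (η₀ * (l * ℓ ^ 2 + L / 2) + Q) * κ) * s := by
  have hη₀ : 0 < η₀ := hη.trans_le hηη₀
  have hQ0 : 0 ≤ Q := by rw [hQ]; positivity
  have hdrift : C * ((1 + 2 / (η * m)) * ℓ ^ 2) ≤ Q / η := by
    have e : 1 + 2 / (η * m) = (η + 2 / m) / η := by field_simp
    rw [e, hQ, div_mul_eq_mul_div, mul_div_assoc', mul_assoc C]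
    gcongr
  have hrα : α / η ≤ δ / η₀ := (div_le_div_iff₀ hη hη₀).2 hαη
  have hrβ : β / η ≤ δ / η₀ := (div_le_div_iff₀ hη hη₀).2 hβη
  -- Absorption of the second-order terms: their coefficient, of order `x²/η`, is at most `x/2`
  -- because `x/η ≤ δ/η₀`.
  have hcoef : ∀ x, 0 ≤ x → x ≤ δ → x / η ≤ δ / η₀ →
      x ^ 2 * (L / 2 + β * l * ℓ ^ 2 + Q / η) ≤ x / 2 := by
    intro x hx hxδ hxr
    have e1 : x ^ 2 * (L / 2 + β * l * ℓ ^ 2 + Q / η)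
        = x * (x * (L / 2) + x * β * (l * ℓ ^ 2) + x / η * Q) := by field_simp
    have e2 : x * (L / 2) + x * β * (l * ℓ ^ 2) + x / η * Q ≤ 1 / 2 := by
      have f1 : x * (L / 2) ≤ δ * (L / 2) := by gcongr
      have f2 : x * β * (l * ℓ ^ 2) ≤ δ * 1 * (l * ℓ ^ 2) := by gcongr <;> linarith
      have f3 : x / η * Q ≤ δ / η₀ * Q := by gcongr
      have f4 : δ * (L / 2 + l * ℓ ^ 2 + Q / η₀)
        = δ * (L / 2) + δ * 1 * (l * ℓ ^ 2) + δ / η₀ * Q := by ring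
      linarith
    rw [e1]
    calc _ ≤ x * (1 / 2) := by gcongr
      _ = x / 2 := by ring
  have hcD : α * g / 2 + β * l ≤ C * (η * m) / 2 := by
    refine le_of_mul_le_mul_right ?_ hη₀
    calc (α * g / 2 + β * l) * η₀ = α * η₀ * (g / 2) + β * η₀ * l := by ring
      _ ≤ δ * η * (g / 2) + δ * η * l := by gcongr
      _ = η * (δ * (g / 2 + l)) := by ring
      _ ≤ η * (C * m * η₀ / 2) := by gcongr
      _ = _ := by ring
  -- Young's inequality and the biases each cost at most `C η m / 2`, so the total factor is `C (1 +
  -- η m)(1 - η m) ≤ C`.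
  have hBpart : (C * (1 + η * m / 2) + (α * g / 2 + β * l)) * B ≤ C * D := by
    calc (C * (1 + η * m / 2) + (α * g / 2 + β * l)) * B
        ≤ (C * (1 + η * m / 2) + C * (η * m) / 2) * ((1 - η * m) * D) := by gcongr
      _ = C * D - C * ((η * m) ^ 2 * D) := by ring
      _ ≤ C * D := sub_le_self _ (by positivity)
  have hNzpart : η ^ 2 * (C * (1 + η * m / 2) + β * l) * Nz
      ≤ η ^ 2 * (C * (1 + η₀ * m / 2) + l) * s := by
    have : β * l ≤ l := mul_le_of_le_one_left hl (hβδ.trans hδ)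
    gcongr
  have hnoise : ∀ x N, 0 ≤ N → N ≤ κ * s → x ^ 2 * (L / 2 + β * l * ℓ ^ 2 + Q / η) * N
      ≤ x ^ 2 / η * ((η₀ * (l * ℓ ^ 2 + L / 2) + Q) * κ) * s := by
    intro x N hN hNs
    have f : L / 2 + β * l * ℓ ^ 2 + Q / η ≤ 1 / η * (η₀ * (l * ℓ ^ 2 + L / 2) + Q) := by
      have f1 : β * l * ℓ ^ 2 ≤ l * ℓ ^ 2 := by
        have : β * l ≤ l := mul_le_of_le_one_left hl (hβδ.trans hδ)
        gcongr
      have f2 : 1 ≤ 1 / η * η₀ := by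
        rw [one_div_mul_eq_div, le_div_iff₀ hη]; linarith
      have f3 : 1 * (l * ℓ ^ 2 + L / 2) ≤ 1 / η * η₀ * (l * ℓ ^ 2 + L / 2) := by gcongr
      have f4 : Q / η = 1 / η * Q := by ring
      linarith
    calc x ^ 2 * (L / 2 + β * l * ℓ ^ 2 + Q / η) * N
        ≤ x ^ 2 * (1 / η * (η₀ * (l * ℓ ^ 2 + L / 2) + Q)) * (κ * s) := by gcongr
      _ = _ := by ring
  have hCW : C * W ≤ C * (1 + η * m / 2) * X
      + Q / η * (α ^ 2 * (My + Ny) + β ^ 2 * (Mu + Nu)) := by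
    calc C * W ≤ C * ((1 + η * m / 2) * X
        + (1 + 2 / (η * m)) * ℓ ^ 2 * (α ^ 2 * (My + Ny) + β ^ 2 * (Mu + Nu))) := by gcongr
      _ = C * (1 + η * m / 2) * X + C * ((1 + 2 / (η * m)) * ℓ ^ 2)
        * (α ^ 2 * (My + Ny) + β ^ 2 * (Mu + Nu)) := by ring
      _ ≤ _ := by gcongr
  have hBu' : β / 2 * Bu ≤ β * l * X + β * l * ℓ ^ 2 * (α ^ 2 * (My + Ny)) := by
    calc β / 2 * Bu ≤ β / 2 * (2 * l * (X + ℓ ^ 2 * α ^ 2 * (My + Ny))) := by gcongr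
      _ = _ := by ring
  have c1 := mul_le_mul_of_nonneg_right (hcoef α hα hαδ hrα) hMy
  have c2 := mul_le_mul_of_nonneg_right (hcoef β hβ hβδ hrβ) hMu
  have c3 := hnoise α Ny hNy hNys
  have c4 := hnoise β Nu hNu hNus
  -- Nonnegative padding: `c5` lets the `u`-step use the same coefficient as the `y`-step, while
  -- `c6` and `c7` supply the cross terms, so that one constant multiplies the whole sum `α²/η +
  -- β²/η + η²`.
  have c5 : 0 ≤ β * l * ℓ ^ 2 * (β ^ 2 * (Mu + Nu)) := by positivity
  have c6 : 0 ≤ (α ^ 2 / η + β ^ 2 / η) * (C * (1 + η₀ * m / 2) + l) * s := by positivity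
  have c7 : 0 ≤ η ^ 2 * ((η₀ * (l * ℓ ^ 2 + L / 2) + Q) * κ) * s := by positivity
  rw [hX] at hCW hBu'
  linarith

end Constants

end S2FOBA

/-! ### Measurability and square integrability -/

namespace S2FOBA

variable {ny nu : ℕ}

lemma pair_continuous : Continuous fun x : Vec ny × Vec nu => pair x.1 x.2 :=
  WithLp.prod_continuous_toLp 2 _ _

section Measurability

variable {Ω : Type*} {mΩ : MeasurableSpace Ω} {μ : Measure Ω}

lemma memLp_pair {y : Ω → Vec ny} {u : Ω → Vec nu} (hy : MemLp y 2 μ) (hu : MemLp u 2 μ) :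
    MemLp (fun ω => pair (y ω) (u ω)) 2 μ := by
  refine (hy.norm.add hu.norm).mono (pair_continuous.comp_aestronglyMeasurable (hy.1.prodMk hu.1))
    (Eventually.of_forall fun ω => ?_)
  exact (norm_pair_le _ _).trans (le_abs_self _)

lemma stronglyMeasurable_pair {m : MeasurableSpace Ω} {y : Ω → Vec ny} {u : Ω → Vec nu}
    (hy : StronglyMeasurable[m] y) (hu : StronglyMeasurable[m] u) :
    StronglyMeasurable[m] (fun ω => pair (y ω) (u ω)) :=
  pair_continuous.comp_stronglyMeasurable (hy.prodMk hu)

end Measurability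

lemma continuous_of_norm_sub_le {E F : Type*} [SeminormedAddCommGroup E]
    [SeminormedAddCommGroup F] {f : E → F} {K : ℝ} (hK : ∀ x y, ‖f x - f y‖ ≤ K * ‖x - y‖) :
    Continuous f :=
  (LipschitzWith.of_dist_le_mul (K := K.toNNReal) fun x y => by
    rw [dist_eq_norm, dist_eq_norm]
    exact (hK x y).trans (mul_le_mul_of_nonneg_right K.le_coe_toNNReal (norm_nonneg _))).continuous

section Phi

variable {j e : Param ny nu → ℝ} {Lj Le : ℝ≥0} {ρ γ : ℝ} {Ω : Type*} {mΩ : MeasurableSpace Ω}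
  {μ : Measure Ω}

lemma norm_gradY_phi_sub_le (h : LowerLevel e Le ρ γ) (hj : IsSmooth Lj j) {c₀ c : ℝ}
    (hc₀ : 0 < c₀) (hc : c₀ ≤ c) (θ θ' : Param ny nu) :
    ‖gradY (phi j e γ c) θ - gradY (phi j e γ c) θ'‖ ≤ phiLip Lj Le ρ γ c₀ * ‖θ - θ'‖ :=
  (norm_fst_le_param (gradient (phi j e γ c) θ - gradient (phi j e γ c) θ')).trans (norm_gradient_phi_sub_le h hj hc₀ hc θ θ')

lemma norm_gradU_phi_sub_le (h : LowerLevel e Le ρ γ) (hj : IsSmooth Lj j) {c₀ c : ℝ}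
    (hc₀ : 0 < c₀) (hc : c₀ ≤ c) (θ θ' : Param ny nu) :
    ‖gradU (phi j e γ c) θ - gradU (phi j e γ c) θ'‖ ≤ phiLip Lj Le ρ γ c₀ * ‖θ - θ'‖ :=
  (norm_snd_le_param (gradient (phi j e γ c) θ - gradient (phi j e γ c) θ')).trans (norm_gradient_phi_sub_le h hj hc₀ hc θ θ')

/-- `phi` is nonnegative and, by its quadratic model at `0`, grows at most quadratically. -/
lemma phi_integrable [IsFiniteMeasure μ] (h : LowerLevel e Le ρ γ) (hj : IsSmooth Lj j)
    (hj_bdd : BddBelow (range j)) {c : ℝ} (hc : 0 < c) {θ : Ω → Param ny nu}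
    (hθ : MemLp θ 2 μ) : Integrable (fun ω => phi j e γ c (θ ω)) μ := by
  set g := gradient (phi j e γ c) 0
  set L := phiLip Lj Le ρ γ c
  have hi : Integrable (fun ω => phi j e γ c 0 + ‖g‖ * ‖θ ω‖ + L / 2 * ‖θ ω‖ ^ 2) μ :=
    ((integrable_const _).add ((hθ.integrable one_le_two).norm.const_mul _)).add
      (hθ.integrable_norm_sq.const_mul _)
  refine hi.mono' ((continuous_of_differentiable
    (phi_differentiable h hj c)).comp_aestronglyMeasurable hθ.1) (Eventually.of_forall fun ω => ?_)
  rw [Real.norm_of_nonneg (phi_nonneg h hj_bdd hc _)]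
  have h1 := phi_quadUpper h hj hc le_rfl 0 (θ ω)
  rw [sub_zero] at h1
  have h2 := real_inner_le_norm g (θ ω)
  linarith

lemma merit_integrable [IsFiniteMeasure μ] (h : LowerLevel e Le ρ γ) (hj : IsSmooth Lj j)
    (hj_bdd : BddBelow (range j)) {c : ℝ} (hc : 0 < c) {θ : Ω → Param ny nu} {z : Ω → Vec ny}
    (hθ : MemLp θ 2 μ) (hz : MemLp z 2 μ) :
    Integrable (fun ω => merit j e Le ρ γ c (θ ω) (z ω)) μ :=
  (phi_integrable h hj hj_bdd hc hθ).add
    ((hz.sub (memLp_two_of_lipschitz h.prox_continuous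
      h.norm_prox_sub_le hθ)).integrable_norm_sq.const_mul _)

lemma norm_add_three_sq_le {H : Type*} [SeminormedAddCommGroup H] (a b c : H) :
    ‖a + b + c‖ ^ 2 ≤ 3 * (‖a‖ ^ 2 + ‖b‖ ^ 2 + ‖c‖ ^ 2) := by
  have := pow_le_pow_left₀ (norm_nonneg _) (norm_add₃_le (a := a) (b := b) (c := c)) 2
  nlinarith [sq_nonneg (‖a‖ - ‖b‖), sq_nonneg (‖a‖ - ‖c‖), sq_nonneg (‖b‖ - ‖c‖)]

lemma integral_norm_lincomb_sq_le {H : Type*} [NormedAddCommGroup H] [InnerProductSpace ℝ H]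
    {a b d : Ω → H}
    (ha : MemLp a 2 μ) (hb : MemLp b 2 μ) (hd : MemLp d 2 μ) {r s t A B D : ℝ}
    (hA : ∫ ω, ‖a ω‖ ^ 2 ∂μ ≤ A) (hB : ∫ ω, ‖b ω‖ ^ 2 ∂μ ≤ B) (hD : ∫ ω, ‖d ω‖ ^ 2 ∂μ ≤ D) :
    ∫ ω, ‖r • a ω + s • b ω + t • d ω‖ ^ 2 ∂μ ≤ 3 * (r ^ 2 * A + s ^ 2 * B + t ^ 2 * D) := by
  have i1 := ha.integrable_norm_sq.const_mul (r ^ 2)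
  have i2 := hb.integrable_norm_sq.const_mul (s ^ 2)
  have i3 := hd.integrable_norm_sq.const_mul (t ^ 2)
  have i4 := (((ha.const_smul r).add (hb.const_smul s)).add (hd.const_smul t)).integrable_norm_sq
  have key : ∀ ω, ‖r • a ω + s • b ω + t • d ω‖ ^ 2
      ≤ 3 * (r ^ 2 * ‖a ω‖ ^ 2 + s ^ 2 * ‖b ω‖ ^ 2 + t ^ 2 * ‖d ω‖ ^ 2) := by
    intro ω
    refine (norm_add_three_sq_le _ _ _).trans (le_of_eq ?_)
    simp only [norm_smul, mul_pow, Real.norm_eq_abs, sq_abs]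
  refine (integral_mono i4 (((i1.add i2).add i3).const_mul 3) key).trans ?_
  have e1 := integral_add (i1.add i2) i3
  have e2 := integral_add i1 i2
  simp only [Pi.add_apply] at e1 e2 ⊢
  rw [integral_const_mul, e1, e2, integral_const_mul, integral_const_mul, integral_const_mul]
  gcongr

end Phi

end S2FOBA

/-! ### Estimates along one iteration -/

namespace S2FOBA

variable {ny nu : ℕ} {j e : Param ny nu → ℝ} {Lj Le : ℝ≥0} {ρ γ : ℝ}

/-- A step in the first component decreases `phi` up to second order. -/
lemma phi_stepY_le (h : LowerLevel e Le ρ γ) (hj : IsSmooth Lj j) {c₀ c : ℝ}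
    (hc₀ : 0 < c₀) (hc : c₀ ≤ c) (y x : Vec ny) (u : Vec nu) (α : ℝ) :
    phi j e γ c (pair (y - α • x) u) ≤ phi j e γ c (pair y u)
      - α * inner ℝ (gradY (phi j e γ c) (pair y u)) x
      + phiLip Lj Le ρ γ c₀ / 2 * α ^ 2 * ‖x‖ ^ 2 := by
  have := (phi_quadUpper h hj hc₀ hc).section_fst u y (y - α • x)
  rw [sub_sub_cancel_left, inner_neg_right, real_inner_smul_right, norm_neg, norm_smul, mul_pow,
    Real.norm_eq_abs, sq_abs] at this
  change _ ≤ phi j e γ c (pair y u) + -(α * inner ℝ (gradY (phi j e γ c) (pair y u)) x) + _ at this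
  linarith

/-- A step in the second component decreases `phi` up to second order. -/
lemma phi_stepU_le (h : LowerLevel e Le ρ γ) (hj : IsSmooth Lj j) {c₀ c : ℝ}
    (hc₀ : 0 < c₀) (hc : c₀ ≤ c) (y : Vec ny) (u x : Vec nu) (β : ℝ) :
    phi j e γ c (pair y (u - β • x)) ≤ phi j e γ c (pair y u)
      - β * inner ℝ (gradU (phi j e γ c) (pair y u)) x
      + phiLip Lj Le ρ γ c₀ / 2 * β ^ 2 * ‖x‖ ^ 2 := by
  have := (phi_quadUpper h hj hc₀ hc).section_snd y u (u - β • x)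
  rw [sub_sub_cancel_left, inner_neg_right, real_inner_smul_right, norm_neg, norm_smul, mul_pow,
    Real.norm_eq_abs, sq_abs] at this
  change _ ≤ phi j e γ c (pair y u) + -(β * inner ℝ (gradU (phi j e γ c) (pair y u)) x) + _ at this
  linarith

/-- Tracking error after a move of the parameters, by Young's inequality. -/
lemma LowerLevel.tracking_sq_le (h : LowerLevel e Le ρ γ) (θ θ' : Param ny nu) (z : Vec ny)
    {t : ℝ} (ht : 0 < t) :
    ‖z - prox e γ θ'‖ ^ 2 ≤ (1 + t) * ‖z - prox e γ θ‖ ^ 2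
      + (1 + 1 / t) * proxLip Le ρ γ ^ 2 * ‖θ' - θ‖ ^ 2 := by
  have h1 := h.norm_prox_sub_le θ θ'
  have h2 : ‖z - prox e γ θ'‖ ≤ ‖z - prox e γ θ‖ + ‖prox e γ θ - prox e γ θ'‖ := by
    simpa using norm_add_le (z - prox e γ θ) (prox e γ θ - prox e γ θ')
  rw [norm_sub_rev θ θ'] at h1
  set a := ‖z - prox e γ θ‖
  set b := proxLip Le ρ γ * ‖θ' - θ‖
  have hb : ‖z - prox e γ θ'‖ ^ 2 ≤ (a + b) ^ 2 :=
    pow_le_pow_left₀ (norm_nonneg _) (h2.trans (by linarith)) 2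
  have h3 : (1 + t) * a ^ 2 + (1 + 1 / t) * b ^ 2 - (a + b) ^ 2 = (t * a - b) ^ 2 / t := by
    field_simp; ring
  have h4 : 0 ≤ (t * a - b) ^ 2 / t := by positivity
  calc _ ≤ (a + b) ^ 2 := hb
    _ ≤ (1 + t) * a ^ 2 + (1 + 1 / t) * b ^ 2 := by linarith
    _ = _ := by simp only [b]; ring

lemma norm_pair_step_sub_sq (y x : Vec ny) (u w : Vec nu) (α β : ℝ) :
    ‖pair (y - α • x) (u - β • w) - pair y u‖ ^ 2 = α ^ 2 * ‖x‖ ^ 2 + β ^ 2 * ‖w‖ ^ 2 := by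
  rw [pair_sub, norm_pair_sq, sub_sub_cancel_left, sub_sub_cancel_left, norm_neg, norm_neg,
    norm_smul, norm_smul, mul_pow, mul_pow, Real.norm_eq_abs, Real.norm_eq_abs, sq_abs, sq_abs]

/-- Bias of the partial gradient in `θ_u` caused by the inexact proximal point. -/
lemma LowerLevel.bias_sq_le (h : LowerLevel e Le ρ γ) (y x z : Vec ny) (u : Vec nu) (α : ℝ) :
    ‖gradU e (pair (prox e γ (pair (y - α • x) u)) u) - gradU e (pair z u)‖ ^ 2
      ≤ 2 * (Le : ℝ) ^ 2 * (‖z - prox e γ (pair y u)‖ ^ 2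
        + proxLip Le ρ γ ^ 2 * α ^ 2 * ‖x‖ ^ 2) := by
  have h1 := norm_gradU_sub_le h.smooth (pair (prox e γ (pair (y - α • x) u)) u) (pair z u)
  rw [pair_sub, sub_self, norm_pair_zero_right, norm_sub_rev _ z] at h1
  -- Young's inequality with parameter `1` gives the factor `2`; only the first block moves here.
  have h2 := h.tracking_sq_le (pair y u) (pair (y - α • x) u) z one_pos
  have h3 := norm_pair_step_sub_sq y x u 0 α 0
  rw [smul_zero, sub_zero] at h3
  rw [h3] at h2
  have h4 := pow_le_pow_left₀ (norm_nonneg _) h1 2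
  rw [mul_pow] at h4
  refine h4.trans ?_
  have h5 : ‖z - prox e γ (pair (y - α • x) u)‖ ^ 2 ≤ 2 * (‖z - prox e γ (pair y u)‖ ^ 2
        + proxLip Le ρ γ ^ 2 * α ^ 2 * ‖x‖ ^ 2) := by
    refine h2.trans (le_of_eq ?_); ring
  calc (Le : ℝ) ^ 2 * ‖z - prox e γ (pair (y - α • x) u)‖ ^ 2
      ≤ (Le : ℝ) ^ 2 * (2 * (‖z - prox e γ (pair y u)‖ ^ 2
        + proxLip Le ρ γ ^ 2 * α ^ 2 * ‖x‖ ^ 2)) := by gcongr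
    _ = _ := by ring

section Constants

variable {η₀ c₀ : ℝ}

lemma LowerLevel.Cz_pos (h : LowerLevel e Le ρ γ) : 0 < Cz Le ρ γ := by
  have h1 : 0 < γ - γ ^ 2 * ρ := by
    have : γ - γ ^ 2 * ρ = γ * (1 - γ * ρ) := by ring
    rw [this]
    exact mul_pos h.gamma_pos (sub_pos.2 h.gamma_mul_rho_lt)
  unfold Cz; positivity

lemma LowerLevel.driftConst_nonneg (h : LowerLevel e Le ρ γ) (hη₀ : 0 < η₀) :
    0 ≤ driftConst Le ρ γ η₀ := by
  have := h.Cz_pos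
  have := h.modulus_pos
  unfold driftConst; positivity

lemma stepBound_denom_pos (h : LowerLevel e Le ρ γ) (hη₀ : 0 < η₀) (hc₀ : 0 < c₀) :
    0 < phiLip Lj Le ρ γ c₀ / 2 + Le ^ 2 * proxLip Le ρ γ ^ 2 + driftConst Le ρ γ η₀ / η₀ + 1 := by
  have := phiLip_nonneg (Lj := Lj) h hc₀
  have := h.driftConst_nonneg hη₀
  positivity

lemma stepBound_pos (h : LowerLevel e Le ρ γ) (hη₀ : 0 < η₀) (hc₀ : 0 < c₀) :
    0 < stepBound Lj Le ρ γ η₀ c₀ := by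
  have h1 := stepBound_denom_pos (Lj := Lj) h hη₀ hc₀
  have h2 := h.Cz_pos
  have h3 := h.modulus_pos
  have h4 := h.gamma_pos
  exact lt_min one_pos (lt_min (by positivity) (by positivity))

lemma noiseConst_pos (h : LowerLevel e Le ρ γ) (hη₀ : 0 < η₀) (hc₀ : 0 < c₀) :
    0 < noiseConst Lj Le ρ γ η₀ c₀ := by
  have h0 := phiLip_nonneg (Lj := Lj) h hc₀
  have h1 := h.driftConst_nonneg hη₀
  have h2 := h.Cz_pos
  have h3 := h.modulus_pos
  have h4 := h.gamma_pos
  unfold noiseConst varConst; positivity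

/-- Smallness needed to absorb the squared directions. The summand `1` in the denominator of
`stepBound` only makes positivity immediate and is dropped here. -/
lemma stepBound_mul_le_half (h : LowerLevel e Le ρ γ) (hη₀ : 0 < η₀) (hc₀ : 0 < c₀) :
    stepBound Lj Le ρ γ η₀ c₀ * (phiLip Lj Le ρ γ c₀ / 2 + Le ^ 2 * proxLip Le ρ γ ^ 2
      + driftConst Le ρ γ η₀ / η₀) ≤ 1 / 2 := by
  have h1 := stepBound_denom_pos (Lj := Lj) h hη₀ hc₀
  have h2 : stepBound Lj Le ρ γ η₀ c₀ ≤ _ := (min_le_right _ _).trans (min_le_left _ _)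
  rw [le_div_iff₀ h1] at h2
  have := stepBound_pos (Lj := Lj) h hη₀ hc₀
  linarith

/-- Smallness needed for the contraction of the tracking error to pay for the biases of both half
steps. -/
lemma stepBound_mul_le (h : LowerLevel e Le ρ γ) :
    stepBound Lj Le ρ γ η₀ c₀ * (1 / γ ^ 2 / 2 + Le ^ 2)
      ≤ Cz Le ρ γ * modulus ρ γ * η₀ / 2 := by
  have h4 := h.gamma_pos
  have h2 : stepBound Lj Le ρ γ η₀ c₀ ≤ _ := (min_le_right _ _).trans (min_le_right _ _)
  rwa [le_div_iff₀ (by positivity)] at h2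

end Constants

lemma integral_le_lincomb {Ω : Type*} {mΩ : MeasurableSpace Ω} {μ : Measure Ω} {f F G K : Ω → ℝ}
    {r s t w : ℝ} (hf : Integrable f μ) (hF : Integrable F μ) (hG : Integrable G μ)
    (hK : Integrable K μ) (hle : ∀ ω, f ω ≤ r * F ω + s * (t * G ω + w * K ω)) :
    ∫ ω, f ω ∂μ ≤ r * ∫ ω, F ω ∂μ + s * (t * ∫ ω, G ω ∂μ + w * ∫ ω, K ω ∂μ) := by
  have i1 := (hG.const_mul t).add (hK.const_mul w)
  have i2 := (hF.const_mul r).add (i1.const_mul s)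
  refine (integral_mono hf i2 hle).trans (le_of_eq ?_)
  have e1 := integral_add (hF.const_mul r) (i1.const_mul s)
  have e2 := integral_add (hG.const_mul t) (hK.const_mul w)
  simp only [Pi.add_apply] at e1 e2 ⊢
  rw [e1, integral_const_mul, integral_const_mul, e2, integral_const_mul, integral_const_mul]

/-- One iteration of the algorithm, as a relation between random variables: `z, y, u` are the
iterates before and `z', y', u'` after the iteration, the remaining vectors are the errors of the
stochastic gradients. -/
structure IsStep {Ω : Type*} {mΩ : MeasurableSpace Ω} (μ : Measure Ω) (j e : Param ny nu → ℝ) (γ c α β η σj σe : ℝ)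
    (𝒢 𝒢' : MeasurableSpace Ω) (z y : Ω → Vec ny) (u : Ω → Vec nu) (z' y' : Ω → Vec ny)
    (u' : Ω → Vec nu) : Prop where
  le : 𝒢 ≤ mΩ
  le' : 𝒢' ≤ mΩ
  memLp_z : MemLp z 2 μ
  memLp_y : MemLp y 2 μ
  memLp_u : MemLp u 2 μ
  meas_z : StronglyMeasurable[𝒢] z
  meas_y : StronglyMeasurable[𝒢] y
  meas_u : StronglyMeasurable[𝒢] u
  meas_z' : StronglyMeasurable[𝒢'] z'
  meas_y' : StronglyMeasurable[𝒢'] y'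
  -- It is the old `u` that appears here: the second half step starts from `(y', u)`, and `u'`
  -- already depends on the next training set.
  meas_u' : StronglyMeasurable[𝒢'] u
  exists_noiseY : ∃ nj ne ν : Ω → Vec ny, IsNoise μ 𝒢 nj ∧ IsNoise μ 𝒢 ne ∧ IsNoise μ 𝒢 ν ∧
    ∫ ω, ‖nj ω‖ ^ 2 ∂μ ≤ σj ^ 2 ∧ ∫ ω, ‖ne ω‖ ^ 2 ∂μ ≤ σe ^ 2 ∧ ∫ ω, ‖ν ω‖ ^ 2 ∂μ ≤ σe ^ 2 ∧
    (∀ ω, z' ω = z ω - η • (gradY e (pair (z ω) (u ω)) + ν ω + (1 / γ) • (z ω - y ω))) ∧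
    (∀ ω, y' ω = y ω - α • ((1 / c) • (gradY j (pair (y ω) (u ω)) + nj ω)
      + (gradY e (pair (y ω) (u ω)) + ne ω) - (1 / γ) • (y ω - z' ω)))
  exists_noiseU : ∃ nj ne ν : Ω → Vec nu, IsNoise μ 𝒢' nj ∧ IsNoise μ 𝒢' ne ∧ IsNoise μ 𝒢' ν ∧
    ∫ ω, ‖nj ω‖ ^ 2 ∂μ ≤ σj ^ 2 ∧ ∫ ω, ‖ne ω‖ ^ 2 ∂μ ≤ σe ^ 2 ∧ ∫ ω, ‖ν ω‖ ^ 2 ∂μ ≤ σe ^ 2 ∧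
    (∀ ω, u' ω = u ω - β • ((1 / c) • (gradU j (pair (y' ω) (u ω)) + nj ω)
      + (gradU e (pair (y' ω) (u ω)) + ne ω) - (gradU e (pair (z' ω) (u ω)) + ν ω)))

section Step

variable {Ω : Type*} {mΩ : MeasurableSpace Ω} {μ : Measure Ω} [IsProbabilityMeasure μ]
  {𝒢 𝒢' : MeasurableSpace Ω}

lemma integral_norm_add_smul_sq_le {H : Type*} [NormedAddCommGroup H] [InnerProductSpace ℝ H]
    [CompleteSpace H] (hm : 𝒢 ≤ mΩ) {X N : Ω → H} (hN : IsNoise μ 𝒢 N)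
    (hX : MemLp X 2 μ) (hXm : StronglyMeasurable[𝒢] X) (r : ℝ) :
    ∫ ω, ‖X ω + r • N ω‖ ^ 2 ∂μ = ∫ ω, ‖X ω‖ ^ 2 ∂μ + r ^ 2 * ∫ ω, ‖N ω‖ ^ 2 ∂μ := by
  rw [(hN.const_smul r).integral_norm_add_sq hm hX hXm]
  simp only [norm_smul, mul_pow, Real.norm_eq_abs, sq_abs]
  rw [integral_const_mul]

/-- Square integrability propagates along the first half of an iteration. -/
lemma memLp_first_half_step {c α η : ℝ} (he : IsSmooth Le e) (hj : IsSmooth Lj j)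
    {z y z' y' nj ne ν : Ω → Vec ny} {u : Ω → Vec nu}
    (hLz : MemLp z 2 μ) (hLy : MemLp y 2 μ) (hLu : MemLp u 2 μ)
    (hnj : MemLp nj 2 μ) (hne : MemLp ne 2 μ) (hν : MemLp ν 2 μ)
    (hz' : ∀ ω, z' ω = z ω - η • (gradY e (pair (z ω) (u ω)) + ν ω + (1 / γ) • (z ω - y ω)))
    (hy' : ∀ ω, y' ω = y ω - α • ((1 / c) • (gradY j (pair (y ω) (u ω)) + nj ω)
      + (gradY e (pair (y ω) (u ω)) + ne ω) - (1 / γ) • (y ω - z' ω))) :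
    MemLp z' 2 μ ∧ MemLp y' 2 μ := by
  have gY : ∀ {L : ℝ≥0} {f : Param ny nu → ℝ}, IsSmooth L f → ∀ {a : Ω → Vec ny} {b : Ω → Vec nu},
      MemLp a 2 μ → MemLp b 2 μ → MemLp (fun ω => gradY f (pair (a ω) (b ω))) 2 μ :=
    fun hf _ _ ha hb => memLp_two_of_lipschitz (continuous_of_norm_sub_le (norm_gradY_sub_le hf))
      (norm_gradY_sub_le hf) (memLp_pair ha hb)
  have hz : MemLp z' 2 μ := by
    rw [funext hz']
    exact hLz.sub ((((gY he hLz hLu).add hν).add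
      ((hLz.sub hLy).const_smul (1 / γ))).const_smul η)
  have hy : MemLp y' 2 μ := by
    rw [funext hy']
    exact hLy.sub (((((gY hj hLy hLu).add hnj).const_smul (1 / c)).add
      ((gY he hLy hLu).add hne)).sub
      ((hLy.sub hz).const_smul (1 / γ)) |>.const_smul α)
  exact ⟨hz, hy⟩

/-- Square integrability propagates along a step. -/
lemma IsStep.memLp {c α β η σj σe : ℝ}
    {z y : Ω → Vec ny} {u : Ω → Vec nu} {z' y' : Ω → Vec ny} {u' : Ω → Vec nu}
    (hs : IsStep μ j e γ c α β η σj σe 𝒢 𝒢' z y u z' y' u') (he : IsSmooth Le e)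
    (hj : IsSmooth Lj j) : MemLp z' 2 μ ∧ MemLp y' 2 μ ∧ MemLp u' 2 μ := by
  obtain ⟨nj, ne, ν, hnj, hne, hν, -, -, -, hz', hy'⟩ := hs.exists_noiseY
  obtain ⟨mj, me, mz, hmj, hme, hmz, -, -, -, hu'⟩ := hs.exists_noiseU
  have gU : ∀ {L : ℝ≥0} {f : Param ny nu → ℝ}, IsSmooth L f → ∀ {a : Ω → Vec ny} {b : Ω → Vec nu},
      MemLp a 2 μ → MemLp b 2 μ → MemLp (fun ω => gradU f (pair (a ω) (b ω))) 2 μ :=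
    fun hf _ _ ha hb => memLp_two_of_lipschitz (continuous_of_norm_sub_le (norm_gradU_sub_le hf))
      (norm_gradU_sub_le hf) (memLp_pair ha hb)
  obtain ⟨hz, hy⟩ := memLp_first_half_step he hj hs.memLp_z hs.memLp_y hs.memLp_u hnj.memLp
    hne.memLp hν.memLp hz' hy'
  refine ⟨hz, hy, ?_⟩
  rw [funext hu']
  exact hs.memLp_u.sub (((((gU hj hy hs.memLp_u).add hmj.memLp).const_smul (1 / c)).add
      ((gU he hy hs.memLp_u).add hme.memLp)).sub
      ((gU he hz hs.memLp_u).add hmz.memLp) |>.const_smul β)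

/-- Descent of the merit function in expectation along one iteration. -/
lemma IsStep.merit_descent {c₀ c α β η η₀ σj σe : ℝ}
    {z y : Ω → Vec ny} {u : Ω → Vec nu} {z' y' : Ω → Vec ny} {u' : Ω → Vec nu}
    (hs : IsStep μ j e γ c α β η σj σe 𝒢 𝒢' z y u z' y' u')
    (h : LowerLevel e Le ρ γ) (hj : IsSmooth Lj j) (hj_bdd : BddBelow (range j))
    (hc₀ : 0 < c₀) (hc : c₀ ≤ c) (hη : 0 < η) (hηη₀ : η ≤ η₀)
    (hη₀ : η₀ * (Le + 2 / γ - ρ) ≤ 2)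
    (hα : 0 ≤ α) (hβ : 0 ≤ β) (hαδ : α ≤ stepBound Lj Le ρ γ η₀ c₀)
    (hβδ : β ≤ stepBound Lj Le ρ γ η₀ c₀)
    (hαη : α * η₀ ≤ stepBound Lj Le ρ γ η₀ c₀ * η)
    (hβη : β * η₀ ≤ stepBound Lj Le ρ γ η₀ c₀ * η) :
    ∫ ω, merit j e Le ρ γ c (pair (y' ω) (u' ω)) (z' ω) ∂μ
      + α / 2 * ∫ ω, ‖gradY (phi j e γ c) (pair (y ω) (u ω))‖ ^ 2 ∂μ
      + β / 2 * ∫ ω, ‖gradU (phi j e γ c) (pair (y' ω) (u ω))‖ ^ 2 ∂μ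
      ≤ ∫ ω, merit j e Le ρ γ c (pair (y ω) (u ω)) (z ω) ∂μ
      + (α ^ 2 / η + β ^ 2 / η + η ^ 2) * noiseConst Lj Le ρ γ η₀ c₀ * (σj ^ 2 + σe ^ 2) := by
  have hηpos₀ : 0 < η₀ := hη.trans_le hηη₀
  have hcpos : 0 < c := hc₀.trans_le hc
  have hγ := h.gamma_pos
  have hm := h.modulus_pos
  obtain ⟨hLz', hLy', hLu'⟩ := hs.memLp h.smooth hj
  obtain ⟨nj, ne, ν, hnj, hne, hν, vnj, vne, vν, hz', hy'⟩ := hs.exists_noiseY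
  obtain ⟨mj, me, mz, hmj, hme, hmz, vmj, vme, vmz, hu'⟩ := hs.exists_noiseU
  have cprox := h.prox_continuous
  have cgY : Continuous (gradY (phi j e γ c)) :=
    continuous_of_norm_sub_le (norm_gradY_phi_sub_le h hj hc₀ hc)
  have cgU : Continuous (gradU (phi j e γ c)) :=
    continuous_of_norm_sub_le (norm_gradU_phi_sub_le h hj hc₀ hc)
  have ceY : Continuous (gradY e) := continuous_of_norm_sub_le (norm_gradY_sub_le h.smooth)
  have ceU : Continuous (gradU e) := continuous_of_norm_sub_le (norm_gradU_sub_le h.smooth)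
  -- the first half step
  have Lθ := memLp_pair hs.memLp_y hs.memLp_u
  have Sθ := stronglyMeasurable_pair hs.meas_y hs.meas_u
  have Lp := memLp_two_of_lipschitz cprox h.norm_prox_sub_le Lθ
  have Sp := cprox.comp_stronglyMeasurable Sθ
  have La := memLp_two_of_lipschitz cgY (norm_gradY_phi_sub_le h hj hc₀ hc) Lθ
  have Sa := cgY.comp_stronglyMeasurable Sθ
  set θ : Ω → Param ny nu := fun ω => pair (y ω) (u ω) with hθ
  set a : Ω → Vec ny := fun ω => gradY (phi j e γ c) (θ ω) with ha
  -- Tracking error after a noise-free `z`-step. It is known given `𝒢`, so the noise `ν` is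
  -- uncorrelated with it, and `d / γ` is exactly the bias of the `y`-direction.
  set d : Ω → Vec ny := fun ω => z ω - η • proxGrad e γ (θ ω) (z ω) - prox e γ (θ ω) with hd
  have LG : MemLp (fun ω => proxGrad e γ (θ ω) (z ω)) 2 μ :=
    (memLp_two_of_lipschitz ceY (norm_gradY_sub_le h.smooth)
      (memLp_pair hs.memLp_z hs.memLp_u)).add ((hs.memLp_z.sub hs.memLp_y).const_smul (1 / γ))
  have SG : StronglyMeasurable[𝒢] (fun ω => proxGrad e γ (θ ω) (z ω)) :=
    (ceY.comp_stronglyMeasurable (stronglyMeasurable_pair hs.meas_z hs.meas_u)).add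
      ((hs.meas_z.sub hs.meas_y).const_smul (1 / γ))
  have Ld : MemLp d 2 μ := (hs.memLp_z.sub (LG.const_smul η)).sub Lp
  have Sd : StronglyMeasurable[𝒢] d := (hs.meas_z.sub (SG.const_smul η)).sub Sp
  set X : Ω → Vec ny := fun ω => a ω + (1 / γ) • d ω with hX
  have LX : MemLp X 2 μ := La.add (Ld.const_smul (1 / γ))
  have SX : StronglyMeasurable[𝒢] X := Sa.add (Sd.const_smul (1 / γ))
  -- The noise `ν` of the `z`-step enters the `y`-update through `z'`, with coefficient `-η/γ`.
  set N : Ω → Vec ny := fun ω => (1 / c) • nj ω + (1 : ℝ) • ne ω + (-(η / γ)) • ν ω with hN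
  have NN : IsNoise μ 𝒢 N := ((hnj.const_smul _).add (hne.const_smul _)).add (hν.const_smul _)
  have ez : ∀ ω, z' ω - prox e γ (θ ω) = d ω + (-η) • ν ω := by
    intro ω
    rw [hz' ω, hd]
    simp only [proxGrad, hθ, pair_fst, pair_snd]
    module
  have ey : ∀ ω, y' ω = y ω - α • (X ω + N ω) := by
    intro ω
    have e1 : y ω - z' ω = (y ω - prox e γ (θ ω)) - (d ω + (-η) • ν ω) := by
      rw [← ez ω]; abel
    rw [hy' ω, e1, hX, hN, ha]
    simp only [gradY_phi h hj]
    simp only [hθ, pair_fst]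
    module
  -- the second half step
  have Lθ2 := memLp_pair hLy' hs.memLp_u
  have Sθ2 := stronglyMeasurable_pair hs.meas_y' hs.meas_u'
  have La2 := memLp_two_of_lipschitz cgU (norm_gradU_phi_sub_le h hj hc₀ hc) Lθ2
  have Sa2 := cgU.comp_stronglyMeasurable Sθ2
  set a2 : Ω → Vec nu := fun ω => gradU (phi j e γ c) (pair (y' ω) (u ω)) with ha2
  set b : Ω → Vec nu := fun ω => gradU e (pair (prox e γ (pair (y' ω) (u ω))) (u ω))
    - gradU e (pair (z' ω) (u ω)) with hb
  have Lb : MemLp b 2 μ :=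
    (memLp_two_of_lipschitz ceU (norm_gradU_sub_le h.smooth)
      (memLp_pair (memLp_two_of_lipschitz cprox h.norm_prox_sub_le Lθ2) hs.memLp_u)).sub
    (memLp_two_of_lipschitz ceU (norm_gradU_sub_le h.smooth) (memLp_pair hLz' hs.memLp_u))
  have Sb : StronglyMeasurable[𝒢'] b :=
    (ceU.comp_stronglyMeasurable (stronglyMeasurable_pair
      (cprox.comp_stronglyMeasurable Sθ2) hs.meas_u')).sub
    (ceU.comp_stronglyMeasurable (stronglyMeasurable_pair hs.meas_z' hs.meas_u'))
  -- The bias `b` contains the noisy `z'`, which is already known given `𝒢'`; hence its bound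
  -- involves the noisy tracking error instead of `d`.
  set X2 : Ω → Vec nu := fun ω => a2 ω + b ω with hX2
  have LX2 : MemLp X2 2 μ := La2.add Lb
  have SX2 : StronglyMeasurable[𝒢'] X2 := Sa2.add Sb
  set N2 : Ω → Vec nu := fun ω => (1 / c) • mj ω + (1 : ℝ) • me ω + (-1 : ℝ) • mz ω with hN2
  have NN2 : IsNoise μ 𝒢' N2 := ((hmj.const_smul _).add (hme.const_smul _)).add (hmz.const_smul _)
  have eu : ∀ ω, u' ω = u ω - β • (X2 ω + N2 ω) := by
    intro ω
    rw [hu' ω, hX2, hN2, ha2, hb]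
    simp only [gradU_phi h hj, pair_snd]
    module
  -- expected descent of both half steps
  have iP0 := phi_integrable h hj hj_bdd hcpos Lθ
  have iP1 := phi_integrable h hj hj_bdd hcpos Lθ2
  have iP2 := phi_integrable h hj hj_bdd hcpos (memLp_pair hLy' hLu')
  have D1 := NN.expected_descent (α := α) (L := phiLip Lj Le ρ γ c₀) hs.le LX SX La Sa iP0 iP1
    (fun ω => by rw [ey ω]; exact phi_stepY_le h hj hc₀ hc (y ω) (X ω + N ω) (u ω) α)
  have D2 := NN2.expected_descent (α := β) (L := phiLip Lj Le ρ γ c₀) hs.le' LX2 SX2 La2 Sa2 iP1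
    iP2 (fun ω => by rw [eu ω]; exact phi_stepU_le h hj hc₀ hc (y' ω) (u ω) (X2 ω + N2 ω) β)
  have eB : ∫ ω, ‖X ω - a ω‖ ^ 2 ∂μ = 1 / γ ^ 2 * ∫ ω, ‖d ω‖ ^ 2 ∂μ := by
    rw [← integral_const_mul]
    refine integral_congr_ae (Eventually.of_forall fun ω => ?_)
    simp only [hX, add_sub_cancel_left, norm_smul, mul_pow, Real.norm_eq_abs, sq_abs]
    ring
  have eB2 : ∫ ω, ‖X2 ω - a2 ω‖ ^ 2 ∂μ = ∫ ω, ‖b ω‖ ^ 2 ∂μ := by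
    simp only [hX2, add_sub_cancel_left]
  -- second moments
  have LXN := LX.add NN.memLp
  have LXN2 := LX2.add NN2.memLp
  have iXN := LXN.integrable_norm_sq
  have iXN2 := LXN2.integrable_norm_sq
  have eXN := NN.integral_norm_add_sq hs.le LX SX
  have eXN2 := NN2.integral_norm_add_sq hs.le' LX2 SX2
  have iT := (hLz'.sub Lp).integrable_norm_sq
  have eT : ∫ ω, ‖z' ω - prox e γ (θ ω)‖ ^ 2 ∂μ
      = ∫ ω, ‖d ω‖ ^ 2 ∂μ + η ^ 2 * ∫ ω, ‖ν ω‖ ^ 2 ∂μ := by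
    simp only [ez]
    rw [integral_norm_add_smul_sq_le hs.le hν Ld Sd, neg_sq]
  have Lp' := memLp_two_of_lipschitz cprox h.norm_prox_sub_le (memLp_pair hLy' hLu')
  have iW := (hLz'.sub Lp').integrable_norm_sq
  have iD := (hs.memLp_z.sub Lp).integrable_norm_sq
  simp only [Pi.sub_apply, Pi.add_apply] at iXN iXN2 iT iW iD
  have hW : ∫ ω, ‖z' ω - prox e γ (pair (y' ω) (u' ω))‖ ^ 2 ∂μ
      ≤ (1 + η * modulus ρ γ / 2) * ∫ ω, ‖z' ω - prox e γ (θ ω)‖ ^ 2 ∂μ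
      + (1 + 2 / (η * modulus ρ γ)) * proxLip Le ρ γ ^ 2
        * (α ^ 2 * (∫ ω, ‖X ω‖ ^ 2 ∂μ + ∫ ω, ‖N ω‖ ^ 2 ∂μ)
          + β ^ 2 * (∫ ω, ‖X2 ω‖ ^ 2 ∂μ + ∫ ω, ‖N2 ω‖ ^ 2 ∂μ)) := by
    rw [← eXN, ← eXN2]
    refine integral_le_lincomb iW iT iXN iXN2 fun ω => ?_
    have := h.tracking_sq_le (θ ω) (pair (y' ω) (u' ω)) (z' ω)
      (t := η * modulus ρ γ / 2) (by positivity)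
    rw [one_div_div] at this
    refine this.trans (le_of_eq ?_)
    rw [← norm_pair_step_sub_sq (y ω) (X ω + N ω) (u ω) (X2 ω + N2 ω), ← ey, ← eu]
  have hBu : ∫ ω, ‖b ω‖ ^ 2 ∂μ ≤ 2 * (Le : ℝ) ^ 2 * (∫ ω, ‖z' ω - prox e γ (θ ω)‖ ^ 2 ∂μ
      + proxLip Le ρ γ ^ 2 * α ^ 2 * (∫ ω, ‖X ω‖ ^ 2 ∂μ + ∫ ω, ‖N ω‖ ^ 2 ∂μ)) := by
    rw [← eXN]
    have key := integral_le_lincomb (r := 0) (s := 2 * (Le : ℝ) ^ 2) (t := 1)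
      (w := proxLip Le ρ γ ^ 2 * α ^ 2) Lb.integrable_norm_sq iT iT iXN fun ω => by
        have := h.bias_sq_le (y ω) (X ω + N ω) (z' ω) (u ω) α
        rw [← ey ω] at this
        rwa [zero_mul, zero_add, one_mul]
    rwa [zero_mul, zero_add, one_mul] at key
  have hB : ∫ ω, ‖d ω‖ ^ 2 ∂μ
      ≤ (1 - η * modulus ρ γ) * ∫ ω, ‖z ω - prox e γ (θ ω)‖ ^ 2 ∂μ := by
    rw [← integral_const_mul]
    refine integral_mono Ld.integrable_norm_sq (iD.const_mul _) fun ω => ?_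
    refine h.norm_proxGrad_step_sub_prox_sq_le hη.le (le_trans ?_ hη₀) (θ ω) (z ω)
    have : 0 ≤ (Le : ℝ) + 2 / γ - ρ := by
      have h1 := Le.coe_nonneg
      have h2 : 2 / γ = 1 / γ + 1 / γ := by ring
      have h3 : 0 < 1 / γ := by positivity
      unfold modulus at hm; linarith
    gcongr
  -- variances
  have hinv : (1 / c) ^ 2 ≤ 1 / c₀ ^ 2 := by
    rw [one_div_pow]; exact one_div_le_one_div_of_le (by positivity) (by gcongr)
  have hsj := sq_nonneg σj
  have hse := sq_nonneg σe
  have hi₀ : 0 ≤ 1 / c₀ ^ 2 := by positivity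
  have hηγ : 0 ≤ η₀ ^ 2 / γ ^ 2 := by positivity
  have hNy : ∫ ω, ‖N ω‖ ^ 2 ∂μ ≤ varConst γ η₀ c₀ * (σj ^ 2 + σe ^ 2) := by
    refine (integral_norm_lincomb_sq_le hnj.memLp hne.memLp hν.memLp vnj vne vν).trans ?_
    have h1 : (-(η / γ)) ^ 2 ≤ η₀ ^ 2 / γ ^ 2 := by
      rw [neg_sq, div_pow]; gcongr
    have h2 := mul_le_mul_of_nonneg_right h1 hse
    have h3 := mul_le_mul_of_nonneg_right hinv hsj
    have h4 := mul_nonneg hi₀ hse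
    have h5 := mul_nonneg hηγ hsj
    unfold varConst
    linarith
  have hNu : ∫ ω, ‖N2 ω‖ ^ 2 ∂μ ≤ varConst γ η₀ c₀ * (σj ^ 2 + σe ^ 2) := by
    refine (integral_norm_lincomb_sq_le hmj.memLp hme.memLp hmz.memLp vmj vme vmz).trans ?_
    have h3 := mul_le_mul_of_nonneg_right hinv hsj
    have h4 := mul_nonneg hi₀ hse
    have h5 := mul_nonneg hηγ hsj
    have h6 := mul_nonneg hηγ hse
    unfold varConst
    linarith
  have nn : ∀ {H : Type} [NormedAddCommGroup H] (f : Ω → H), 0 ≤ ∫ ω, ‖f ω‖ ^ 2 ∂μ :=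
    fun f => integral_nonneg fun ω => sq_nonneg _
  have key := merit_descent_arith (Q := driftConst Le ρ γ η₀) (l := (Le : ℝ) ^ 2)
    (g := 1 / γ ^ 2) (κ := varConst γ η₀ c₀) (s := σj ^ 2 + σe ^ 2) (Nz := ∫ ω, ‖ν ω‖ ^ 2 ∂μ)
    (D := ∫ ω, ‖z ω - prox e γ (θ ω)‖ ^ 2 ∂μ)
    hm (phiLip_nonneg h hc₀) h.Cz_pos.le (sq_nonneg _) (by positivity) hη hηη₀ hα hβ hαδ hβδ
    hαη hβη (min_le_left _ _) rfl (stepBound_mul_le_half h hηpos₀ hc₀) (stepBound_mul_le h)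
    (by unfold varConst; positivity) (by positivity) (nn d) (nn X) (nn N) (nn X2) (nn N2)
    (integral_nonneg fun ω => sq_nonneg _) (nn ν) (by linarith) hNy hNu (eB ▸ D1) (eB2 ▸ D2) eT hW
    hB hBu
  have em' : ∫ ω, merit j e Le ρ γ c (pair (y' ω) (u' ω)) (z' ω) ∂μ
      = ∫ ω, phi j e γ c (pair (y' ω) (u' ω)) ∂μ
        + Cz Le ρ γ * ∫ ω, ‖z' ω - prox e γ (pair (y' ω) (u' ω))‖ ^ 2 ∂μ := by
    rw [← integral_const_mul, ← integral_add iP2 (iW.const_mul _)]; rfl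
  have em : ∫ ω, merit j e Le ρ γ c (pair (y ω) (u ω)) (z ω) ∂μ
      = ∫ ω, phi j e γ c (θ ω) ∂μ + Cz Le ρ γ * ∫ ω, ‖z ω - prox e γ (θ ω)‖ ^ 2 ∂μ := by
    rw [← integral_const_mul, ← integral_add iP0 (iD.const_mul _)]; rfl
  rw [em', em]
  exact key

end Step

end S2FOBA

/-! ### The algorithm as a sequence of abstract steps -/

namespace S2FOBA

variable {ny nu : ℕ} {Ω S : Type*} {mΩ : MeasurableSpace Ω} [MeasurableSpace S]

lemma past_mono (T : ℕ → Ω → S) {n m : ℕ} (hnm : n ≤ m) : past T n ≤ past T m :=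
  iSup_le fun i => le_iSup_of_le (⟨i, i.2.trans_le hnm⟩ : Fin m) le_rfl

lemma past_le {T : ℕ → Ω → S} (hT : ∀ n, Measurable (T n)) (n : ℕ) : past T n ≤ mΩ :=
  iSup_le fun i => (hT i).comap_le

lemma measurable_past (T : ℕ → Ω → S) {i n : ℕ} (hi : i < n) : Measurable[past T n] (T i) :=
  measurable_iff_comap_le.2 (le_iSup_of_le (⟨i, hi⟩ : Fin n) le_rfl)

lemma measurable_fst_param : Measurable fun θ : Param ny nu => θ.fst :=
  (continuous_of_norm_sub_le (K := 1) fun x y => by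
    rw [one_mul]; exact norm_fst_le_param (x - y)).measurable

lemma measurable_snd_param : Measurable fun θ : Param ny nu => θ.snd :=
  (continuous_of_norm_sub_le (K := 1) fun x y => by
    rw [one_mul]; exact norm_snd_le_param (x - y)).measurable

lemma measurable_pair {m : MeasurableSpace Ω} {y : Ω → Vec ny} {u : Ω → Vec nu}
    (hy : Measurable[m] y) (hu : Measurable[m] u) : Measurable[m] fun ω => pair (y ω) (u ω) :=
  pair_continuous.measurable.comp (hy.prodMk hu)

namespace Config

variable {A : Config S ny nu} {T : ℕ → Ω → S}

lemma measurable_oracle {G : S → Param ny nu → Param ny nu}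
    (hG : Measurable fun x : S × Param ny nu => G x.1 x.2) {m : MeasurableSpace Ω}
    {s : Ω → S} {y : Ω → Vec ny} {u : Ω → Vec nu}
    (hs : Measurable[m] s) (hy : Measurable[m] y) (hu : Measurable[m] u) :
    Measurable[m] fun ω => G (s ω) (pair (y ω) (u ω)) :=
  hG.comp (hs.prodMk (measurable_pair hy hu))

/-- Only `𝒯_k` is needed for `z^{k+1}` and `θ_y^{k+1}`, so with `m = past T (2k+1)` they are
`ℱ_{k+1/2}`-measurable. -/
lemma measurable_next (hGj : Measurable fun x : S × Param ny nu => A.Gj x.1 x.2)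
    (hGe : Measurable fun x : S × Param ny nu => A.Ge x.1 x.2) (k : ℕ)
    {m : MeasurableSpace Ω} {s : Ω → S} {x : Ω → State ny nu} (hs : Measurable[m] s)
    (hz : Measurable[m] fun ω => (x ω).z) (hy : Measurable[m] fun ω => (x ω).y)
    (hu : Measurable[m] fun ω => (x ω).u) :
    Measurable[m] (fun ω => A.zNext k (s ω) (x ω)) ∧
      Measurable[m] (fun ω => A.yNext k (s ω) (x ω)) := by
  have h1 : Measurable[m] (fun ω => A.zNext k (s ω) (x ω)) :=
    hz.sub (((measurable_fst_param.comp (measurable_oracle hGe hs hz hu)).add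
      ((hz.sub hy).const_smul (1 / A.γ))).const_smul (A.η k))
  refine ⟨h1, ?_⟩
  exact hy.sub (((((measurable_fst_param.comp (measurable_oracle hGj hs hy hu)).const_smul
    (1 / A.c k)).add (measurable_fst_param.comp (measurable_oracle hGe hs hy hu))).sub
      ((hy.sub h1).const_smul (1 / A.γ))).const_smul (A.α k))

lemma measurable_uNext (hGj : Measurable fun x : S × Param ny nu => A.Gj x.1 x.2)
    (hGe : Measurable fun x : S × Param ny nu => A.Ge x.1 x.2) (k : ℕ)
    {m : MeasurableSpace Ω} {s s' : Ω → S} {x : Ω → State ny nu} (hs : Measurable[m] s)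
    (hs' : Measurable[m] s')
    (hz : Measurable[m] fun ω => (x ω).z) (hy : Measurable[m] fun ω => (x ω).y)
    (hu : Measurable[m] fun ω => (x ω).u) :
    Measurable[m] (fun ω => A.uNext k (s ω) (s' ω) (x ω)) := by
  obtain ⟨h1, h2⟩ := measurable_next hGj hGe k hs hz hy hu
  exact hu.sub (((((measurable_snd_param.comp (measurable_oracle hGj hs' h2 hu)).const_smul
    (1 / A.c k)).add (measurable_snd_param.comp (measurable_oracle hGe hs' h2 hu))).sub
      (measurable_snd_param.comp (measurable_oracle hGe hs' h1 hu))).const_smul (A.β k))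

/-- The iterate number `k` is determined by the training sets drawn before `𝒯_k`. -/
lemma measurable_iter (hGj : Measurable fun x : S × Param ny nu => A.Gj x.1 x.2)
    (hGe : Measurable fun x : S × Param ny nu => A.Ge x.1 x.2) (T : ℕ → Ω → S) (k : ℕ) :
    Measurable[past T (2 * k)] (fun ω => (A.iter (T · ω) k).z) ∧
      Measurable[past T (2 * k)] (fun ω => (A.iter (T · ω) k).y) ∧
      Measurable[past T (2 * k)] (fun ω => (A.iter (T · ω) k).u) := by
  induction k with
  | zero => exact ⟨measurable_const, measurable_const, measurable_const⟩
  | succ k ih =>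
    have hle : past T (2 * k) ≤ past T (2 * (k + 1)) := past_mono T (by omega)
    have hz := ih.1.mono hle le_rfl
    have hy := ih.2.1.mono hle le_rfl
    have hu := ih.2.2.mono hle le_rfl
    have hs := measurable_past T (show 2 * k < 2 * (k + 1) by omega)
    have hs' := measurable_past T (show 2 * k + 1 < 2 * (k + 1) by omega)
    obtain ⟨h1, h2⟩ := measurable_next hGj hGe k hs hz hy hu
    exact ⟨h1, h2, measurable_uNext hGj hGe k hs hs' hz hy hu⟩

lemma isStep {μ : Measure Ω} [IsProbabilityMeasure μ] {j e : Param ny nu → ℝ} {Lj Le : ℝ≥0}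
    {σj σe : ℝ} (hj : IsSmooth Lj j) (he : IsSmooth Le e)
    (hGj : Measurable fun x : S × Param ny nu => A.Gj x.1 x.2)
    (hGe : Measurable fun x : S × Param ny nu => A.Ge x.1 x.2)
    (hT : ∀ n, Measurable (T n)) (hA : OracleAssumption μ j e σj σe A T) (k : ℕ)
    (hLz : MemLp (fun ω => (A.iter (T · ω) k).z) 2 μ)
    (hLy : MemLp (fun ω => (A.iter (T · ω) k).y) 2 μ)
    (hLu : MemLp (fun ω => (A.iter (T · ω) k).u) 2 μ) :
    IsStep μ j e A.γ (A.c k) (A.α k) (A.β k) (A.η k) σj σe (past T (2 * k)) (past T (2 * k + 1))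
      (fun ω => (A.iter (T · ω) k).z) (fun ω => (A.iter (T · ω) k).y)
      (fun ω => (A.iter (T · ω) k).u) (fun ω => (A.iter (T · ω) (k + 1)).z)
      (fun ω => (A.iter (T · ω) (k + 1)).y) (fun ω => (A.iter (T · ω) (k + 1)).u) := by
  have le := past_le hT (2 * k)
  have le' := past_le hT (2 * k + 1)
  obtain ⟨hz, hy, hu⟩ := measurable_iter hGj hGe T k
  have hle : past T (2 * k) ≤ past T (2 * k + 1) := past_mono T (by omega)
  have hu1 := hu.mono hle le_rfl
  obtain ⟨hz', hy'⟩ := measurable_next hGj hGe k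
    (measurable_past T (show 2 * k < 2 * k + 1 by omega)) (hz.mono hle le_rfl) (hy.mono hle le_rfl) hu1
  have key : ∀ {n : ℕ} {𝒢 : MeasurableSpace Ω} (_ : 𝒢 ≤ mΩ) {a : Ω → Vec ny} {b : Ω → Vec nu}
      {h : Ω → Vec n} {F : Param ny nu → Vec n} {σ K : ℝ} (_ : MemLp a 2 μ) (_ : MemLp b 2 μ)
      (_ : Measurable[𝒢] a) (_ : Measurable[𝒢] b) (_ : ∀ x y, ‖F x - F y‖ ≤ K * ‖x - y‖)
      (_ : IsUnbiasedOracle μ 𝒢 h (fun ω => F (pair (a ω) (b ω))) σ),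
      IsNoise μ 𝒢 (fun ω => h ω - F (pair (a ω) (b ω))) := by
    intro n 𝒢 hm a b h F σ K ha hb ha' hb' hF ho
    exact ho.isNoise hm
      (memLp_two_of_lipschitz (continuous_of_norm_sub_le hF) hF (memLp_pair ha hb))
      ((continuous_of_norm_sub_le hF).comp_stronglyMeasurable
        (stronglyMeasurable_pair ha'.stronglyMeasurable hb'.stronglyMeasurable))
  -- The first half step comes separately: it yields the square integrability of `z^{k+1}` and
  -- `θ_y^{k+1}`, without which the errors of the second half step are not known to be noise.
  have hY : ∃ nj ne ν : Ω → Vec ny, IsNoise μ (past T (2 * k)) nj ∧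
      IsNoise μ (past T (2 * k)) ne ∧ IsNoise μ (past T (2 * k)) ν ∧
    ∫ ω, ‖nj ω‖ ^ 2 ∂μ ≤ σj ^ 2 ∧ ∫ ω, ‖ne ω‖ ^ 2 ∂μ ≤ σe ^ 2 ∧ ∫ ω, ‖ν ω‖ ^ 2 ∂μ ≤ σe ^ 2 ∧
    (∀ ω, (A.iter (T · ω) (k + 1)).z = (A.iter (T · ω) k).z - A.η k •
      (gradY e (pair (A.iter (T · ω) k).z (A.iter (T · ω) k).u) + ν ω
        + (1 / A.γ) • ((A.iter (T · ω) k).z - (A.iter (T · ω) k).y))) ∧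
    (∀ ω, (A.iter (T · ω) (k + 1)).y = (A.iter (T · ω) k).y - A.α k •
      ((1 / A.c k) • (gradY j (pair (A.iter (T · ω) k).y (A.iter (T · ω) k).u) + nj ω)
      + (gradY e (pair (A.iter (T · ω) k).y (A.iter (T · ω) k).u) + ne ω)
      - (1 / A.γ) • ((A.iter (T · ω) k).y - (A.iter (T · ω) (k + 1)).z))) := by
    refine ⟨_, _, _, key le hLy hLu hy hu (norm_gradY_sub_le hj) (hA.jy k),
      key le hLy hLu hy hu (norm_gradY_sub_le he) (hA.ey k),
      key le hLz hLu hz hu (norm_gradY_sub_le he) (hA.eyz k),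
      (hA.jy k).integral_sq_le le, (hA.ey k).integral_sq_le le, (hA.eyz k).integral_sq_le le,
      fun ω => ?_, fun ω => ?_⟩ <;>
    · simp only [add_sub_cancel]; rfl
  obtain ⟨hLz', hLy'⟩ : MemLp (fun ω => (A.iter (T · ω) (k + 1)).z) 2 μ ∧
      MemLp (fun ω => (A.iter (T · ω) (k + 1)).y) 2 μ := by
    obtain ⟨nj, ne, ν, hnj, hne, hν, -, -, -, ez, ey⟩ := hY
    exact memLp_first_half_step he hj hLz hLy hLu hnj.memLp hne.memLp hν.memLp ez ey
  refine ⟨le, le', hLz, hLy, hLu, hz.stronglyMeasurable, hy.stronglyMeasurable,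
    hu.stronglyMeasurable, hz'.stronglyMeasurable, hy'.stronglyMeasurable, hu1.stronglyMeasurable,
    hY, ?_⟩
  refine ⟨_, _, _, key le' hLy' hLu hy' hu1 (norm_gradU_sub_le hj) (hA.ju k),
      key le' hLy' hLu hy' hu1 (norm_gradU_sub_le he) (hA.eu k),
      key le' hLz' hLu hz' hu1 (norm_gradU_sub_le he) (hA.euz k),
      (hA.ju k).integral_sq_le le', (hA.eu k).integral_sq_le le', (hA.euz k).integral_sq_le le',
      fun ω => ?_⟩
  simp only [add_sub_cancel]; rfl

end Config

end S2FOBA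

/-! ### Step sizes, summation and the rate -/

namespace S2FOBA

section StepSize

lemma stepSize_pos {a : ℝ} (ha : 0 < a) (r : ℝ) (k : ℕ) : 0 < stepSize a r k := by
  unfold stepSize; positivity

lemma stepSize_le {a r : ℝ} (ha : 0 ≤ a) (hr : 0 ≤ r) (k : ℕ) : stepSize a r k ≤ a :=
  mul_le_of_le_one_right ha
    (Real.rpow_le_one_of_one_le_of_nonpos (le_add_of_nonneg_left k.cast_nonneg) (by linarith))

/-- Division-free form of `α_k / η_k ≤ δ / η₀`, valid because `θ` has the faster decaying steps. -/
lemma stepSize_mul_le {a b d p q : ℝ} (hb : 0 ≤ b) (hd : 0 ≤ d) (had : a ≤ d)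
    (hqp : q ≤ p) (k : ℕ) : stepSize a p k * b ≤ d * stepSize b q k := by
  have h1 : ((k : ℝ) + 1) ^ (-p) ≤ ((k : ℝ) + 1) ^ (-q) :=
    Real.rpow_le_rpow_of_exponent_le (le_add_of_nonneg_left k.cast_nonneg) (by linarith)
  unfold stepSize
  calc a * ((k : ℝ) + 1) ^ (-p) * b = a * b * ((k : ℝ) + 1) ^ (-p) := by ring
    _ ≤ d * b * ((k : ℝ) + 1) ^ (-q) := by gcongr
    _ = _ := by ring

lemma summable_add_one_rpow {r : ℝ} (hr : r < -1) : Summable fun k : ℕ => ((k : ℝ) + 1) ^ r := by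
  simpa using (summable_nat_add_iff 1).2 (Real.summable_nat_rpow.2 hr)

lemma summable_stepSize_sq {b q : ℝ} (hq : 1 / 2 < q) :
    Summable fun k => stepSize b q k ^ 2 := by
  refine ((summable_add_one_rpow (r := -q * 2) (by linarith)).mul_left (b ^ 2)).congr fun k => ?_
  rw [stepSize, mul_pow, ← Real.rpow_mul_natCast (by positivity)]
  simp

/-- The exponent is `q - 2p`, below `-1` exactly when `p > (q + 1)/2`. -/
lemma summable_stepSize_sq_div {a b p q : ℝ} (hpq : (q + 1) / 2 < p) :
    Summable fun k => stepSize a p k ^ 2 / stepSize b q k := by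
  refine ((summable_add_one_rpow (r := -p * 2 - -q) (by linarith)).mul_left (a ^ 2 / b)).congr
    fun k => ?_
  rw [stepSize, stepSize, mul_pow, ← Real.rpow_mul_natCast (by positivity),
    Real.rpow_sub (by positivity), mul_div_mul_comm]
  simp

end StepSize

lemma telescope_le {v a b r : ℕ → ℝ} (h : ∀ k, v (k + 1) + a k + b k ≤ v k + r k) (K : ℕ) :
    v K + ∑ k ∈ Finset.range K, a k + ∑ k ∈ Finset.range K, b k
      ≤ v 0 + ∑ k ∈ Finset.range K, r k := by
  induction K with
  | zero => simp
  | succ K ih =>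
    simp only [Finset.sum_range_succ]
    linarith [h K]

/-- The best iterate rate from a weighted sum bound. -/
lemma isBigO_inf'_of_sum_le {g G H : ℕ → ℝ} {a b p R : ℝ} (ha : 0 < a) (hb : 0 < b) (hp : 0 < p) (hp1 : p ≤ 1)
    (hg : ∀ k, 0 ≤ g k) (hG : ∀ k, 0 ≤ G k) (hH : ∀ k, 0 ≤ H k)
    (hgGH : ∀ k, g k ^ 2 ≤ 2 * (G k + H k))
    (hR : ∀ K, ∑ k ∈ Finset.range (K + 1), stepSize a p k / 2 * G k
      + ∑ k ∈ Finset.range (K + 1), stepSize b p k / 2 * H k ≤ R) :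
    (fun K : ℕ => (Finset.range (K + 1)).inf' Finset.nonempty_range_add_one g)
      =O[atTop] (fun K : ℕ => 1 / (K : ℝ) ^ ((1 - p) / 2)) := by
  set w := min a b
  have hw : 0 < w := lt_min ha hb
  refine Asymptotics.IsBigO.of_bound (Real.sqrt (4 * R / w)) ?_
  filter_upwards [eventually_ge_atTop 1] with K hK
  have hK0 : (0 : ℝ) < K := by exact_mod_cast hK
  set i := (Finset.range (K + 1)).inf' Finset.nonempty_range_add_one g
  have hi0 : 0 ≤ i := Finset.le_inf' _ _ fun k _ => hg k
  -- Every weight up to `K` is at least `w (K+1)^(-p)`. Summing `K + 1` such terms gives `i²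
  -- (K+1)^(1-p) ≤ 4 R / w`; the `4` combines the halved weights with the factor `2` in `hgGH`.
  have hterm : ∀ k ∈ Finset.range (K + 1), w * ((K : ℝ) + 1) ^ (-p) / 4 * i ^ 2
      ≤ stepSize a p k / 2 * G k + stepSize b p k / 2 * H k := by
    intro k hk
    have hkK : (k : ℝ) + 1 ≤ K + 1 := by exact_mod_cast Finset.mem_range.1 hk
    have h1 : ((K : ℝ) + 1) ^ (-p) ≤ ((k : ℝ) + 1) ^ (-p) :=
      Real.rpow_le_rpow_of_nonpos (by positivity) hkK (by linarith)
    have h2 : i ^ 2 ≤ 2 * (G k + H k) :=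
      (pow_le_pow_left₀ hi0 (Finset.inf'_le g hk) 2).trans (hgGH k)
    have h3 : w * ((K : ℝ) + 1) ^ (-p) ≤ stepSize a p k := by
      unfold stepSize; gcongr; exact min_le_left _ _
    have h4 : w * ((K : ℝ) + 1) ^ (-p) ≤ stepSize b p k := by
      unfold stepSize; gcongr; exact min_le_right _ _
    have := hG k
    have := hH k
    calc w * ((K : ℝ) + 1) ^ (-p) / 4 * i ^ 2
        ≤ w * ((K : ℝ) + 1) ^ (-p) / 4 * (2 * (G k + H k)) := by gcongr
      _ = w * ((K : ℝ) + 1) ^ (-p) / 2 * G k + w * ((K : ℝ) + 1) ^ (-p) / 2 * H k := by ring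
      _ ≤ _ := by gcongr
  have hsum := (Finset.sum_le_sum hterm).trans (Finset.sum_add_distrib.le.trans (hR K))
  rw [Finset.sum_const, Finset.card_range, nsmul_eq_mul] at hsum
  have hpow : ((K : ℝ) + 1) * ((K : ℝ) + 1) ^ (-p) = ((K : ℝ) + 1) ^ (1 - p) := by
    rw [sub_eq_add_neg, Real.rpow_add (by positivity), Real.rpow_one]
  have hKp : (K : ℝ) ^ (1 - p) ≤ ((K : ℝ) + 1) ^ (1 - p) :=
    Real.rpow_le_rpow hK0.le (by linarith) (by linarith)
  have hsq : (i * (K : ℝ) ^ ((1 - p) / 2)) ^ 2 ≤ 4 * R / w := by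
    have e : ((K : ℝ) ^ ((1 - p) / 2)) ^ 2 = (K : ℝ) ^ (1 - p) := by
      rw [← Real.rpow_mul_natCast hK0.le]; norm_num
    rw [mul_pow, e, le_div_iff₀ hw]
    calc i ^ 2 * (K : ℝ) ^ (1 - p) * w ≤ i ^ 2 * ((K : ℝ) + 1) ^ (1 - p) * w := by gcongr
      _ = 4 * (((K + 1 : ℕ) : ℝ) * (w * ((K : ℝ) + 1) ^ (-p) / 4 * i ^ 2)) := by
        rw [← hpow]; push_cast; ring
      _ ≤ 4 * R := by linarith
  rw [Real.norm_of_nonneg hi0, Real.norm_of_nonneg (by positivity), mul_one_div,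
    le_div_iff₀ (by positivity)]
  exact Real.le_sqrt_of_sq_le hsq

/-- Jensen's inequality, in the form of nonnegativity of the variance, followed by `(f + g)² ≤ 2 (f²
+ g²)`. -/
lemma sq_integral_add_le {Ω : Type*} {mΩ : MeasurableSpace Ω} {μ : Measure Ω}
    [IsProbabilityMeasure μ] {f g : Ω → ℝ} (hf : MemLp f 2 μ) (hg : MemLp g 2 μ) :
    (∫ ω, (f ω + g ω) ∂μ) ^ 2 ≤ 2 * (∫ ω, f ω ^ 2 ∂μ + ∫ ω, g ω ^ 2 ∂μ) := by
  have h1 := hf.integrable_sq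
  have h2 := hg.integrable_sq
  have hfg := hf.add hg
  have h3 : (∫ ω, (f ω + g ω) ∂μ) ^ 2 ≤ ∫ ω, (f ω + g ω) ^ 2 ∂μ := by
    have hv := ProbabilityTheory.variance_nonneg (f + g) μ
    rw [ProbabilityTheory.variance_eq_sub hfg] at hv
    exact sub_nonneg.1 hv
  refine h3.trans ?_
  rw [← integral_add h1 h2, ← integral_const_mul]
  refine integral_mono hfg.integrable_sq ((h1.add h2).const_mul 2) fun ω => ?_
  nlinarith [sq_nonneg (f ω - g ω)]

end S2FOBA

end

/-! ### Proof of the theorem -/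

theorem theorem4p1 {ny nu : ℕ} (j e : S2FOBA.Param ny nu → ℝ)
    (Lj Le : ℝ≥0) (ρ γ η₀ c₀ : ℝ)
    (hj_bdd : BddBelow (range j))
    (hρ : 0 < ρ) (he_weak : S2FOBA.IsWeaklyConvex ρ e)
    (hj_smooth : S2FOBA.IsSmooth Lj j) (he_smooth : S2FOBA.IsSmooth Le e)
    (hγ : γ ∈ Ioo 0 (1 / (2 * ρ)))
    (hη₀ : η₀ ∈ Ioo 0 (2 / ((Le : ℝ) + 2 / γ - ρ)))
    (hc₀ : 0 < c₀) :
    -- the proximal point is well defined and `φ_c` is differentiable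
    (∀ θ, ∃! z, IsMinOn (S2FOBA.proxObj e γ θ) univ z) ∧
    (∀ c : ℝ, 0 < c → Differentiable ℝ (S2FOBA.phi j e γ c)) ∧
    ∃ δ : ℝ, 0 < δ ∧ ∃ Cσ : ℝ, 0 < Cσ ∧
      ∀ (α₀ β₀ p q σj σe : ℝ), α₀ ∈ Ioc 0 δ → β₀ ∈ Ioc 0 δ →
        q ∈ Ioo (1 / 2) 1 → p ∈ Ioo ((q + 1) / 2) 1 →
      ∃ MV : ℝ, 0 < MV ∧
        ∀ {Ω : Type*} {mΩ : MeasurableSpace Ω} (μ : Measure Ω) [IsProbabilityMeasure μ]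
          {S : Type*} [MeasurableSpace S] (A : S2FOBA.Config S ny nu) (T : ℕ → Ω → S),
          A.γ = γ →
          A.α = S2FOBA.stepSize α₀ p →
          A.β = S2FOBA.stepSize β₀ p →
          A.η = S2FOBA.stepSize η₀ q →
          A.c 0 = c₀ → Monotone A.c →
          Measurable (fun x : S × S2FOBA.Param ny nu => A.Gj x.1 x.2) →
          Measurable (fun x : S × S2FOBA.Param ny nu => A.Ge x.1 x.2) →
          (∀ n, Measurable (T n)) →
          S2FOBA.OracleAssumption μ j e σj σe A T →
          -- all expectations below are those of integrable random variables
          (∀ k, Integrable (fun ω => S2FOBA.V j e Le ρ A (T · ω) k) μ ∧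
            Integrable (fun ω => S2FOBA.normGradY j e A (T · ω) k ^ 2) μ ∧
            Integrable (fun ω => S2FOBA.normGradU j e A (T · ω) k ^ 2) μ ∧
            Integrable (fun ω => S2FOBA.normGradY j e A (T · ω) k
              + S2FOBA.normGradU j e A (T · ω) k) μ) ∧
          -- descent of the merit function in expectation
          (∀ k, (∫ ω, S2FOBA.V j e Le ρ A (T · ω) (k + 1) ∂μ)
              + A.α k / 2 * (∫ ω, S2FOBA.normGradY j e A (T · ω) k ^ 2 ∂μ)
              + A.β k / 2 * (∫ ω, S2FOBA.normGradU j e A (T · ω) k ^ 2 ∂μ)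
            ≤ (∫ ω, S2FOBA.V j e Le ρ A (T · ω) k ∂μ)
              + (A.α k ^ 2 / A.η k + A.β k ^ 2 / A.η k + A.η k ^ 2)
                * Cσ * (σj ^ 2 + σe ^ 2)) ∧
          -- the accumulated bound; `V_0` is deterministic
          (∀ K : ℕ, (∫ ω, S2FOBA.V j e Le ρ A (T · ω) (K + 1) ∂μ)
              + (∑ k ∈ Finset.range (K + 1),
                  A.α k / 2 * (∫ ω, S2FOBA.normGradY j e A (T · ω) k ^ 2 ∂μ))
              + (∑ k ∈ Finset.range (K + 1),
                  A.β k / 2 * (∫ ω, S2FOBA.normGradU j e A (T · ω) k ^ 2 ∂μ))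
            ≤ S2FOBA.merit j e Le ρ γ c₀ A.θ₀ A.z₀ + MV) ∧
          -- boundedness of `E[V_k]`, summability of the noise and of the squared gradients
          (∀ k, 0 ≤ ∫ ω, S2FOBA.V j e Le ρ A (T · ω) k ∂μ ∧
            (∫ ω, S2FOBA.V j e Le ρ A (T · ω) k ∂μ)
              ≤ S2FOBA.merit j e Le ρ γ c₀ A.θ₀ A.z₀ + MV) ∧
          Summable (fun k => A.α k ^ 2 / A.η k + A.β k ^ 2 / A.η k + A.η k ^ 2) ∧
          Summable (fun k => A.α k * ∫ ω, S2FOBA.normGradY j e A (T · ω) k ^ 2 ∂μ) ∧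
          Summable (fun k => A.β k * ∫ ω, S2FOBA.normGradU j e A (T · ω) k ^ 2 ∂μ) ∧
          -- the rate
          (fun K : ℕ => (Finset.range (K + 1)).inf' Finset.nonempty_range_add_one
              (fun k => ∫ ω, (S2FOBA.normGradY j e A (T · ω) k
                + S2FOBA.normGradU j e A (T · ω) k) ∂μ))
            =O[atTop] (fun K : ℕ => 1 / (K : ℝ) ^ ((1 - p) / 2)) := by
  have hγ0 : 0 < γ := hγ.1
  have hγρ : γ * ρ < 1 := by
    have := hγ.2
    rw [lt_div_iff₀ (by positivity)] at this
    linarith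
  have h : S2FOBA.LowerLevel e Le ρ γ := ⟨hρ, he_weak, he_smooth, hγ0, hγρ⟩
  have hη₀pos : 0 < η₀ := hη₀.1
  have hη₀' : η₀ * (Le + 2 / γ - ρ) ≤ 2 := by
    have hpos : 0 < (Le : ℝ) + 2 / γ - ρ := by
      have h1 := h.modulus_pos
      have h2 : 2 / γ = 1 / γ + 1 / γ := by ring
      have h3 : 0 < 1 / γ := by positivity
      have h4 := Le.coe_nonneg
      unfold S2FOBA.modulus at h1
      linarith
    exact ((lt_div_iff₀ hpos).1 hη₀.2).le
  have hδ := S2FOBA.stepBound_pos (Lj := Lj) h hη₀pos hc₀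
  refine ⟨h.existsUnique_isMinOn, fun c _ => S2FOBA.phi_differentiable h hj_smooth c,
    S2FOBA.stepBound Lj Le ρ γ η₀ c₀, hδ, S2FOBA.noiseConst Lj Le ρ γ η₀ c₀,
    S2FOBA.noiseConst_pos h hη₀pos hc₀, ?_⟩
  intro α₀ β₀ p q σj σe hα₀ hβ₀ hq hp
  set Cσ := S2FOBA.noiseConst Lj Le ρ γ η₀ c₀
  have hCσ : 0 < Cσ := S2FOBA.noiseConst_pos h hη₀pos hc₀
  have hqp : q ≤ p := by linarith [hp.1, hq.2]
  have hp0 : 0 < p := by linarith [hp.1, hq.1]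
  set r : ℕ → ℝ := fun k => S2FOBA.stepSize α₀ p k ^ 2 / S2FOBA.stepSize η₀ q k
    + S2FOBA.stepSize β₀ p k ^ 2 / S2FOBA.stepSize η₀ q k + S2FOBA.stepSize η₀ q k ^ 2 with hr
  have hrsum : Summable r := ((S2FOBA.summable_stepSize_sq_div hp.1).add
    (S2FOBA.summable_stepSize_sq_div hp.1)).add (S2FOBA.summable_stepSize_sq hq.1)
  have hr0 : ∀ k, 0 ≤ r k := fun k => by
    have := S2FOBA.stepSize_pos hη₀pos q k
    simp only [hr]; positivity
  have hts : 0 ≤ (∑' k, r k) * Cσ * (σj ^ 2 + σe ^ 2) := by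
    have : 0 ≤ ∑' k, r k := tsum_nonneg hr0
    positivity
  -- The summand `1` only ensures `MV > 0` when both variances vanish.
  refine ⟨(∑' k, r k) * Cσ * (σj ^ 2 + σe ^ 2) + 1, by linarith, ?_⟩
  intro Ω mΩ μ _ S _ A T hAγ hAα hAβ hAη hAc hmono hGj hGe hT hA
  have hcle : ∀ k, c₀ ≤ A.c k := fun k => hAc ▸ hmono (Nat.zero_le k)
  have hcpos : ∀ k, 0 < A.c k := fun k => hc₀.trans_le (hcle k)
  have hstep := S2FOBA.Config.isStep hj_smooth he_smooth hGj hGe hT hA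
  have hL : ∀ k, MemLp (fun ω => (A.iter (T · ω) k).z) 2 μ ∧
      MemLp (fun ω => (A.iter (T · ω) k).y) 2 μ ∧ MemLp (fun ω => (A.iter (T · ω) k).u) 2 μ := by
    intro k
    induction k with
    | zero => exact ⟨memLp_const _, memLp_const _, memLp_const _⟩
    | succ k ih => exact (hstep k ih.1 ih.2.1 ih.2.2).memLp he_smooth hj_smooth
  have hLθ : ∀ k, MemLp (fun ω => A.θ (T · ω) k) 2 μ :=
    fun k => S2FOBA.memLp_pair (hL k).2.1 (hL k).2.2
  have hLθhalf : ∀ k, MemLp (fun ω => A.θhalf (T · ω) k) 2 μ :=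
    fun k => S2FOBA.memLp_pair (hL (k + 1)).2.1 (hL k).2.2
  have iV : ∀ c, 0 < c → ∀ k, Integrable (fun ω => S2FOBA.merit j e Le ρ A.γ c (A.θ (T · ω) k)
      (A.iter (T · ω) k).z) μ := fun c hc k => by
    rw [hAγ]; exact S2FOBA.merit_integrable h hj_smooth hj_bdd hc (hLθ k) (hL k).1
  have lipY := fun k => S2FOBA.norm_gradY_phi_sub_le h hj_smooth hc₀ (hcle k)
  have lipU := fun k => S2FOBA.norm_gradU_phi_sub_le h hj_smooth hc₀ (hcle k)
  have mY : ∀ k, MemLp (fun ω => S2FOBA.normGradY j e A (T · ω) k) 2 μ := fun k => by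
    unfold S2FOBA.normGradY
    rw [hAγ]
    exact (S2FOBA.memLp_two_of_lipschitz (S2FOBA.continuous_of_norm_sub_le (lipY k)) (lipY k)
      (hLθ k)).norm
  have mU : ∀ k, MemLp (fun ω => S2FOBA.normGradU j e A (T · ω) k) 2 μ := fun k => by
    unfold S2FOBA.normGradU
    rw [hAγ]
    exact (S2FOBA.memLp_two_of_lipschitz (S2FOBA.continuous_of_norm_sub_le (lipU k)) (lipU k)
      (hLθhalf k)).norm
  have hdesc : ∀ k, (∫ ω, S2FOBA.V j e Le ρ A (T · ω) (k + 1) ∂μ)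
      + A.α k / 2 * (∫ ω, S2FOBA.normGradY j e A (T · ω) k ^ 2 ∂μ)
      + A.β k / 2 * (∫ ω, S2FOBA.normGradU j e A (T · ω) k ^ 2 ∂μ)
      ≤ (∫ ω, S2FOBA.V j e Le ρ A (T · ω) k ∂μ)
        + (A.α k ^ 2 / A.η k + A.β k ^ 2 / A.η k + A.η k ^ 2) * Cσ * (σj ^ 2 + σe ^ 2) := by
    intro k
    have hs := hstep k (hL k).1 (hL k).2.1 (hL k).2.2
    -- The one-step estimate keeps `c_k` throughout; passing to `c_{k+1}` on the left only lowers
    -- the merit function.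
    have h1 : ∫ ω, S2FOBA.V j e Le ρ A (T · ω) (k + 1) ∂μ
        ≤ ∫ ω, S2FOBA.merit j e Le ρ A.γ (A.c k) (A.θ (T · ω) (k + 1))
          (A.iter (T · ω) (k + 1)).z ∂μ :=
      integral_mono (iV _ (hcpos (k + 1)) (k + 1)) (iV _ (hcpos k) (k + 1)) fun ω =>
        add_le_add_left (S2FOBA.phi_anti hj_bdd (hcpos k) (hmono k.le_succ) _) _
    rw [hAγ, hAα, hAβ, hAη] at hs
    have h2 := hs.merit_descent h hj_smooth hj_bdd hc₀ (hcle k) (S2FOBA.stepSize_pos hη₀pos q k)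
      (S2FOBA.stepSize_le hη₀pos.le (by linarith [hq.1]) k) hη₀'
      (S2FOBA.stepSize_pos hα₀.1 p k).le (S2FOBA.stepSize_pos hβ₀.1 p k).le
      ((S2FOBA.stepSize_le hα₀.1.le hp0.le k).trans hα₀.2)
      ((S2FOBA.stepSize_le hβ₀.1.le hp0.le k).trans hβ₀.2)
      (S2FOBA.stepSize_mul_le hη₀pos.le hδ.le hα₀.2 hqp k)
      (S2FOBA.stepSize_mul_le hη₀pos.le hδ.le hβ₀.2 hqp k)
    rw [← hAγ, ← hAα, ← hAβ, ← hAη] at h2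
    have h3 := add_le_add_left (add_le_add_left h1
      (A.α k / 2 * (∫ ω, S2FOBA.normGradY j e A (T · ω) k ^ 2 ∂μ)))
      (A.β k / 2 * (∫ ω, S2FOBA.normGradU j e A (T · ω) k ^ 2 ∂μ))
    refine h3.trans ?_
    simp only [Cσ, ← hAγ]
    exact h2
  have hVnonneg : ∀ k, 0 ≤ ∫ ω, S2FOBA.V j e Le ρ A (T · ω) k ∂μ := fun k =>
    integral_nonneg fun ω => add_nonneg
      (by rw [hAγ]; exact S2FOBA.phi_nonneg h hj_bdd (hcpos k) _)
      (mul_nonneg h.Cz_pos.le (sq_nonneg _) |> fun h' => by rw [hAγ]; exact h')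
  have hV0 : ∫ ω, S2FOBA.V j e Le ρ A (T · ω) 0 ∂μ = S2FOBA.merit j e Le ρ γ c₀ A.θ₀ A.z₀ := by
    have e0 : ∀ ω, S2FOBA.V j e Le ρ A (T · ω) 0 = S2FOBA.merit j e Le ρ γ c₀ A.θ₀ A.z₀ := by
      intro ω; rw [← hAγ, ← hAc]; rfl
    simp only [e0, integral_const, probReal_univ, one_smul]
  have hαpos : ∀ k, 0 < A.α k := fun k => hAα ▸ S2FOBA.stepSize_pos hα₀.1 p k
  have hβpos : ∀ k, 0 < A.β k := fun k => hAβ ▸ S2FOBA.stepSize_pos hβ₀.1 p k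
  have hG : ∀ k, 0 ≤ ∫ ω, S2FOBA.normGradY j e A (T · ω) k ^ 2 ∂μ :=
    fun k => integral_nonneg fun ω => sq_nonneg _
  have hH : ∀ k, 0 ≤ ∫ ω, S2FOBA.normGradU j e A (T · ω) k ^ 2 ∂μ :=
    fun k => integral_nonneg fun ω => sq_nonneg _
  have hrA : (fun k => A.α k ^ 2 / A.η k + A.β k ^ 2 / A.η k + A.η k ^ 2) = r := by
    rw [hAα, hAβ, hAη]
  -- Stated with `V_K` and sums over `k < K`, so that it also covers `K = 0`; the accumulated bound
  -- of the theorem is the instance `K + 1`.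
  have hacc : ∀ K : ℕ, (∫ ω, S2FOBA.V j e Le ρ A (T · ω) K ∂μ)
      + (∑ k ∈ Finset.range K, A.α k / 2 * (∫ ω, S2FOBA.normGradY j e A (T · ω) k ^ 2 ∂μ))
      + (∑ k ∈ Finset.range K, A.β k / 2 * (∫ ω, S2FOBA.normGradU j e A (T · ω) k ^ 2 ∂μ))
      ≤ S2FOBA.merit j e Le ρ γ c₀ A.θ₀ A.z₀
        + ((∑' k, r k) * Cσ * (σj ^ 2 + σe ^ 2) + 1) := by
    intro K
    refine (S2FOBA.telescope_le (v := fun k => ∫ ω, S2FOBA.V j e Le ρ A (T · ω) k ∂μ)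
      (a := fun k => A.α k / 2 * (∫ ω, S2FOBA.normGradY j e A (T · ω) k ^ 2 ∂μ))
      (b := fun k => A.β k / 2 * (∫ ω, S2FOBA.normGradU j e A (T · ω) k ^ 2 ∂μ))
      (r := fun k => (A.α k ^ 2 / A.η k + A.β k ^ 2 / A.η k + A.η k ^ 2) * Cσ
        * (σj ^ 2 + σe ^ 2)) hdesc K).trans ?_
    rw [hV0, ← Finset.sum_mul, ← Finset.sum_mul]
    have h1 : ∑ k ∈ Finset.range K, (A.α k ^ 2 / A.η k + A.β k ^ 2 / A.η k + A.η k ^ 2)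
        ≤ ∑' k, r k := by
      rw [← hrA] at hrsum hr0 ⊢
      exact hrsum.sum_le_tsum _ fun k _ => hr0 k
    have h2 : (∑ k ∈ Finset.range K, (A.α k ^ 2 / A.η k + A.β k ^ 2 / A.η k + A.η k ^ 2)) * Cσ
        * (σj ^ 2 + σe ^ 2) ≤ (∑' k, r k) * Cσ * (σj ^ 2 + σe ^ 2) := by gcongr
    linarith
  have hsG : ∀ K, 0 ≤ ∑ k ∈ Finset.range K,
      A.α k / 2 * (∫ ω, S2FOBA.normGradY j e A (T · ω) k ^ 2 ∂μ) := fun K =>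
    Finset.sum_nonneg fun k _ => mul_nonneg (half_pos (hαpos k)).le (hG k)
  have hsH : ∀ K, 0 ≤ ∑ k ∈ Finset.range K,
      A.β k / 2 * (∫ ω, S2FOBA.normGradU j e A (T · ω) k ^ 2 ∂μ) := fun K =>
    Finset.sum_nonneg fun k _ => mul_nonneg (half_pos (hβpos k)).le (hH k)
  refine ⟨fun k => ⟨iV _ (hcpos k) k, (mY k).integrable_sq, (mU k).integrable_sq,
    ((mY k).integrable one_le_two).add ((mU k).integrable one_le_two)⟩, hdesc,
    fun K => hacc (K + 1), fun k => ⟨hVnonneg k, ?_⟩, hrA ▸ hrsum, ?_, ?_, ?_⟩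
  · linarith [hacc k, hsG k, hsH k]
  · refine summable_of_sum_range_le (fun k => mul_nonneg (hαpos k).le (hG k))
      (c := 2 * (S2FOBA.merit j e Le ρ γ c₀ A.θ₀ A.z₀
        + ((∑' k, r k) * Cσ * (σj ^ 2 + σe ^ 2) + 1))) fun K => ?_
    have e1 : ∑ k ∈ Finset.range K, A.α k * ∫ ω, S2FOBA.normGradY j e A (T · ω) k ^ 2 ∂μ
        = 2 * ∑ k ∈ Finset.range K,
          A.α k / 2 * (∫ ω, S2FOBA.normGradY j e A (T · ω) k ^ 2 ∂μ) := by
      rw [Finset.mul_sum]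
      exact Finset.sum_congr rfl fun k _ => by ring
    rw [e1]
    linarith [hacc K, hsH K, hVnonneg K]
  · refine summable_of_sum_range_le (fun k => mul_nonneg (hβpos k).le (hH k))
      (c := 2 * (S2FOBA.merit j e Le ρ γ c₀ A.θ₀ A.z₀
        + ((∑' k, r k) * Cσ * (σj ^ 2 + σe ^ 2) + 1))) fun K => ?_
    have e1 : ∑ k ∈ Finset.range K, A.β k * ∫ ω, S2FOBA.normGradU j e A (T · ω) k ^ 2 ∂μ
        = 2 * ∑ k ∈ Finset.range K,
          A.β k / 2 * (∫ ω, S2FOBA.normGradU j e A (T · ω) k ^ 2 ∂μ) := by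
      rw [Finset.mul_sum]
      exact Finset.sum_congr rfl fun k _ => by ring
    rw [e1]
    linarith [hacc K, hsG K, hVnonneg K]
  · refine S2FOBA.isBigO_inf'_of_sum_le hα₀.1 hβ₀.1 hp0 hp.2.le
      (fun k => integral_nonneg fun ω => add_nonneg (norm_nonneg _) (norm_nonneg _)) hG hH
      (fun k => S2FOBA.sq_integral_add_le (mY k) (mU k))
      (R := S2FOBA.merit j e Le ρ γ c₀ A.θ₀ A.z₀
        + ((∑' k, r k) * Cσ * (σj ^ 2 + σe ^ 2) + 1)) fun K => ?_
    rw [← hAα, ← hAβ]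
    linarith [hacc (K + 1), hVnonneg (K + 1)]
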